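/- Let $p$ be a prime and $n\ge 0$ an integer. For an abelian group $M$, let $\widehat S(\mathbb Z;M)=1\times\prod_{k\ge1}M^{\otimes k}$ be the multiplicative group of power series $1+m_1t+m_2t^2+\cdots$ with $m_k\in M^{\otimes k}$, inside the completed tensor algebra of $M$ and with the product of the discrete topologies. Let $W_{\langle p^n\rangle}(\mathbb Z;M)$ be its quotient by the smallest closed normal subgroup that contains all commutators and all elements $1-m_1\otimes\dots\otimes m_k\,t^k$ with $k\notin\{1,p,\dots,p^n\}$; it is an abelian group, written additively. Let $\tau^{n}\colon M\to W_{\langle p^n\rangle}(\mathbb Z;M)$ be the Teichmüller map $m\mapsto [1-mt]$ and, for $0\le i\le n$, let $V^i\colon W_{\langle p^{n-i}\rangle}(\mathbb Z;M^{\otimes p^i})\to W_{\langle p^n\rangle}(\mathbb Z;M)$ be the iterated Verschiebung, induced by $t\mapsto t^{p^i}$. Every element of $W_{\langle p^n\rangle}(\mathbb Z;M)$ is the class of a product $\prod_{i=0}^n(1-m_it^{p^i})$ with $m_i\in M^{\otimes p^i}$, and its ghost components are $$w_j(m_0,\dots,m_n)=\sum_{i=0}^{j}\ \sum_{\sigma\in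 C_{p^j}/C_{p^{j-i}}}\sigma\big(m_i^{\otimes p^{j-i}}\big)\in M^{\otimes p^j}\qquad(0\le j\le n),$$ where $C_{p^j}$ acts by cyclically permuting the tensor factors. Let $X$ and $Y$ be sets, with free abelian groups $\mathbb Z(X)$ and $\mathbb Z(Y)$. (1) For $0\le i\le n$ and $x=(x_1,\dots,x_{p^i})\in X^{\times p^i}$ the element $V^i\tau^{n-i}(x_1\otimes\dots\otimes x_{p^i})\in W_{\langle p^n\rangle}(\mathbb Z;\mathbb Z(X))$ depends only on the $C_{p^i}$-orbit of $x$, and $W_{\langle p^n\rangle}(\mathbb Z;\mathbb Z(X))$ is a free abelian group with basis these elements, indexed by the pairs of $0\le i\le n$ and an orbit in $X^{\times p^i}/C_{p^i}$: $$W_{\langle p^n\rangle}(\mathbb Z;\mathbb Z(X))\cong\bigoplus_{i=0}^n\ \bigoplus_{x\in X^{\times p^i}/C_{p^i}}\mathbb Z\cdot V^i\tau^{n-i}(x_1\otimes\dots\otimes x_{p^i}).$$ (2) There is exactly one biadditive map $\star\colon W_{\langle p^n\rangle}(\mathbb Z;\mathbb Z(X))\times W_{\langle p^n\rangle}(\mathbb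 Z;\mathbb Z(Y))\to W_{\langle p^n\rangle}(\mathbb Z;\mathbb Z(X)\otimes\mathbb Z(Y))$ such that $w_j(a\star b)=w_j(a)\otimes w_j(b)$ for all $a$, $b$ and $0\le j\le n$, where $\mathbb Z(X)^{\otimes k}\otimes\mathbb Z(Y)^{\otimes k}$ is identified with $(\mathbb Z(X)\otimes\mathbb Z(Y))^{\otimes k}$ by the shuffle permutation; it is the structure map of the lax symmetric monoidal functor $W_{\langle p^n\rangle}$. For $0\le i,j\le n$, $x\in X^{\times p^i}$ and $y\in Y^{\times p^j}$ it satisfies $$V^i\tau^{n-i}(\otimes_{l=1}^{p^i} x_l)\star V^j\tau^{n-j}(\otimes_{h=1}^{p^j} y_h)=\sum_{\sigma\in C_{p^i}}V^j\tau^{n-j}\Big(\big(\sigma(\otimes_{l=1}^{p^i}x_l)\big)^{\otimes p^{j-i}}\otimes(\otimes_{h=1}^{p^j}y_h)\Big)\quad\text{if } i\le j,$$ $$V^i\tau^{n-i}(\otimes_{l=1}^{p^i} x_l)\star V^j\tau^{n-j}(\otimes_{h=1}^{p^j} y_h)=\sum_{\sigma\in C_{p^j}}V^i\tau^{n-i}\Big((\otimes_{l=1}^{p^i}x_l)\otimes\big(\sigma(\otimes_{h=1}^{p^j}y_h)\big)^{\otimes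 p^{i-j}}\Big)\quad\text{if } j\le i.$$ -/

import Mathlib

open scoped TensorProduct

noncomputable section

namespace WittCoeff

/-! ### The completed tensor algebra and its special units -/

section Series

variable (R : Type*) [CommRing R] (M : Type*) [AddCommGroup M] [Module R M]

/-- The copy of the tensor power `M^{⊗k}` inside the tensor algebra. -/
def deg (k : ℕ) : Submodule R (TensorAlgebra R M) :=
  LinearMap.range (TensorPower.toTensorAlgebra : (⨂[R]^k M) →ₗ[R] TensorAlgebra R M)

variable {R M}

theorem mul_mem_deg {i j : ℕ} {a b : TensorAlgebra R M} (ha : a ∈ deg R M i)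
    (hb : b ∈ deg R M j) : a * b ∈ deg R M (i + j) := by
  obtain ⟨a, rfl⟩ := ha
  obtain ⟨b, rfl⟩ := hb
  exact ⟨_, TensorPower.toTensorAlgebra_gMul a b⟩

theorem one_mem_deg : (1 : TensorAlgebra R M) ∈ deg R M 0 :=
  ⟨_, TensorPower.toTensorAlgebra_gOne⟩

variable (R M)

/-- The multiplicative group of special units `1 + m₁ t + m₂ t² + ⋯`, with `m_k ∈ M^{⊗k}`, of the
completed tensor algebra `∏_k M^{⊗k}`.  The completed tensor algebra is the ring of those power
series in a central variable `t` over the tensor algebra whose `k`-th coefficient lies in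
`M^{⊗k}`. -/
def SpecialUnits : Subgroup (PowerSeries (TensorAlgebra R M))ˣ where
  carrier := {u | PowerSeries.constantCoeff (u : PowerSeries (TensorAlgebra R M)) = 1 ∧
    ∀ k, PowerSeries.coeff k (u : PowerSeries (TensorAlgebra R M)) ∈ deg R M k}
  one_mem' := by
    refine ⟨by simp, fun k => ?_⟩
    rw [Units.val_one, PowerSeries.coeff_one]
    split_ifs with h
    · subst h; exact one_mem_deg
    · exact zero_mem _
  mul_mem' := by
    rintro u v ⟨hu, hu'⟩ ⟨hv, hv'⟩
    refine ⟨by simp [hu, hv], fun k => ?_⟩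
    rw [Units.val_mul, PowerSeries.coeff_mul]
    refine Submodule.sum_mem _ fun x hx => ?_
    rw [← Finset.HasAntidiagonal.mem_antidiagonal.1 hx]
    exact mul_mem_deg (hu' _) (hv' _)
  inv_mem' := by
    rintro u ⟨hu, hu'⟩
    have h1 : (u : PowerSeries (TensorAlgebra R M)) * ↑u⁻¹ = 1 := u.mul_inv
    have h0 : PowerSeries.constantCoeff (↑u⁻¹ : PowerSeries (TensorAlgebra R M)) = 1 := by
      have h := congrArg PowerSeries.constantCoeff h1
      rwa [map_mul, hu, one_mul, map_one] at h
    refine ⟨h0, fun k => ?_⟩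
    induction k using Nat.strong_induction_on with
    | _ k ih =>
      rcases Nat.eq_zero_or_pos k with rfl | hk
      · rw [PowerSeries.coeff_zero_eq_constantCoeff_apply, h0]; exact one_mem_deg
      · have h2 := congrArg (PowerSeries.coeff k) h1
        rw [PowerSeries.coeff_mul, PowerSeries.coeff_one, if_neg hk.ne',
          ← Finset.add_sum_erase _ _ (a := ((0, k) : ℕ × ℕ)) (by simp),
          PowerSeries.coeff_zero_eq_constantCoeff_apply, hu, one_mul] at h2
        rw [eq_neg_of_add_eq_zero_left h2]
        refine Submodule.neg_mem _ (Submodule.sum_mem _ fun x hx => ?_)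
        obtain ⟨hx0, hx⟩ := Finset.mem_erase.1 hx
        have hx' := Finset.HasAntidiagonal.mem_antidiagonal.1 hx
        rw [← hx']
        refine mul_mem_deg (hu' _) (ih _ ?_)
        rcases x with ⟨a, b⟩
        have : a ≠ 0 := by
          rintro rfl
          simp only [zero_add] at hx'
          exact hx0 (by rw [hx'])
        simp only at hx' ⊢
        omega

/-- The topology of `∏_{k ≥ 1} M^{⊗k}` on the special units: the product of the discrete
topologies. -/
instance : TopologicalSpace (SpecialUnits R M) :=
  TopologicalSpace.induced
    (fun u (k : ℕ) => PowerSeries.coeff k (u.1 : PowerSeries (TensorAlgebra R M)))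
    (@Pi.topologicalSpace ℕ (fun _ => TensorAlgebra R M) fun _ => ⊥)

variable {M}

/-- The special unit `1 - a t^k`, for `k ≥ 1` and `a ∈ M^{⊗k}`. -/
def oneSub (k : ℕ) (hk : 0 < k) (a : ⨂[R]^k M) : SpecialUnits R M :=
  let f : PowerSeries (TensorAlgebra R M) :=
    1 - PowerSeries.monomial k (TensorPower.toTensorAlgebra a)
  have hf : PowerSeries.constantCoeff f = ((1 : (TensorAlgebra R M)ˣ) : TensorAlgebra R M) := by
    rw [← PowerSeries.coeff_zero_eq_constantCoeff_apply, map_sub, PowerSeries.coeff_monomial,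
      if_neg hk.ne, PowerSeries.coeff_one, if_pos rfl, sub_zero, Units.val_one]
  ⟨⟨f, PowerSeries.invOfUnit f 1, PowerSeries.mul_invOfUnit f 1 hf,
      PowerSeries.invOfUnit_mul f 1 hf⟩, by
    refine ⟨hf, fun l => ?_⟩
    change PowerSeries.coeff l f ∈ _
    simp only [f, map_sub, PowerSeries.coeff_one, PowerSeries.coeff_monomial]
    refine Submodule.sub_mem _ ?_ ?_
    · split_ifs with h
      · subst h; exact one_mem_deg
      · exact zero_mem _
    · split_ifs with h
      · subst h; exact ⟨a, rfl⟩
      · exact zero_mem _⟩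

/-! ### The truncated Witt vectors with coefficients -/

variable (M)

/-- The elements that become trivial in the `p`-typical `(n+1)`-truncated Witt vectors:
commutators, and the series `1 - m₁ ⊗ ⋯ ⊗ m_k t^k` with `k ∉ {1, p, …, p^n}`. (For a module over a
commutative ring, seen as a bimodule, `r m = m r`, so that there are no relations
`τ(rm) ∼ τ(mr)` to impose.) -/
def relators (p n : ℕ) : Set (SpecialUnits R M) :=
  {u | ∃ f g : SpecialUnits R M, u = f * g * f⁻¹ * g⁻¹} ∪
  {u | ∃ (k : ℕ) (hk : 0 < k) (m : Fin k → M), (∀ i ≤ n, k ≠ p ^ i) ∧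
    u = oneSub R k hk (PiTensorProduct.tprod R m)}

/-- The smallest closed normal subgroup of the special units that contains the relators. -/
def relSubgroup (p n : ℕ) : Subgroup (SpecialUnits R M) :=
  sInf {N | N.Normal ∧ IsClosed (N : Set (SpecialUnits R M)) ∧ relators R M p n ⊆ N}

instance (p n : ℕ) : (relSubgroup R M p n).Normal :=
  ⟨fun x hx g => Subgroup.mem_sInf.2 fun N hN =>
    hN.1.conj_mem x (Subgroup.mem_sInf.1 hx N hN) g⟩

theorem relators_subset (p n : ℕ) : relators R M p n ⊆ relSubgroup R M p n :=
  fun _ hx => Subgroup.mem_sInf.2 fun _ hN => hN.2.2 hx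

instance (p n : ℕ) : CommGroup (SpecialUnits R M ⧸ relSubgroup R M p n) :=
  { (inferInstance : Group (SpecialUnits R M ⧸ relSubgroup R M p n)) with
    mul_comm := by
      intro a b
      induction a using QuotientGroup.induction_on with | H a
      induction b using QuotientGroup.induction_on with | H b
      rw [← QuotientGroup.mk_mul, ← QuotientGroup.mk_mul, QuotientGroup.eq]
      refine relators_subset R M p n (Or.inl ⟨b⁻¹, a⁻¹, ?_⟩)
      simp only [mul_inv_rev, inv_inv, mul_assoc] }

/-- The `p`-typical `(n+1)`-truncated Witt vectors `W_{⟨p^n⟩}(R; M)` of `R` with coefficients in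
`M`, for a module `M` over a commutative ring `R`, written additively. -/
abbrev W (p n : ℕ) : Type _ := Additive (SpecialUnits R M ⧸ relSubgroup R M p n)

variable {M}

/-- The class in `W_{⟨p^n⟩}(R; M)` of a special unit. -/
def W.mk (p n : ℕ) (u : SpecialUnits R M) : W R M p n :=
  Additive.ofMul (QuotientGroup.mk u)

/-- The Teichmüller map `m ↦ 1 - m t`. -/
def teich (p n : ℕ) (m : M) : W R M p n :=
  W.mk R p n (oneSub R 1 one_pos (PiTensorProduct.tprod R fun _ => m))

/-! ### The Verschiebung -/

variable (M)

/-- The algebra map `T(M^{⊗r}) → T(M)` which identifies `(M^{⊗r})^{⊗k}` with `M^{⊗rk}`. -/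
def flatten (r : ℕ) : TensorAlgebra R (⨂[R]^r M) →ₐ[R] TensorAlgebra R M :=
  TensorAlgebra.lift R TensorPower.toTensorAlgebra

theorem flatten_mem (r k : ℕ) {a : TensorAlgebra R (⨂[R]^r M)}
    (ha : a ∈ deg R (⨂[R]^r M) k) : flatten R M r a ∈ deg R M (r * k) := by
  obtain ⟨a, rfl⟩ := ha
  induction a using PiTensorProduct.induction_on with
  | smul_tprod c x =>
    rw [map_smul, map_smul]
    refine Submodule.smul_mem _ _ ?_
    rw [TensorPower.toTensorAlgebra_tprod, TensorAlgebra.tprod_apply]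
    clear c
    induction k with
    | zero => simpa using one_mem_deg
    | succ k ih =>
      rw [List.ofFn_succ, List.prod_cons, map_mul, mul_add, mul_one, add_comm]
      exact mul_mem_deg ⟨x 0, by simp [flatten]⟩ (ih fun i => x i.succ)
  | add a b ha hb =>
    rw [map_add, map_add]
    exact Submodule.add_mem _ ha hb

/-- The ring map `∑ a_k t^k ↦ ∑ a_k t^{rk}`, where `a_k ∈ (M^{⊗r})^{⊗k}` is regarded as an element
of `M^{⊗rk}`. -/
def expand (r : ℕ) (hr : 0 < r) :
    PowerSeries (TensorAlgebra R (⨂[R]^r M)) →+* PowerSeries (TensorAlgebra R M) where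
  toFun f := PowerSeries.mk fun k =>
    if r ∣ k then flatten R M r (PowerSeries.coeff (k / r) f) else 0
  map_one' := by
    ext k
    rw [PowerSeries.coeff_mk, PowerSeries.coeff_one, PowerSeries.coeff_one]
    rcases Nat.eq_zero_or_pos k with rfl | hk
    · simp
    · by_cases h : r ∣ k
      · have : k / r ≠ 0 := (Nat.div_pos (Nat.le_of_dvd hk h) hr).ne'
        simp [h, this, hk.ne']
      · simp [h, hk.ne']
  map_zero' := by ext k; simp
  map_add' f g := by
    ext k
    simp only [PowerSeries.coeff_mk, map_add]
    split_ifs <;> simp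
  map_mul' f g := by
    ext k
    simp only [PowerSeries.coeff_mk, PowerSeries.coeff_mul]
    by_cases h : r ∣ k
    · obtain ⟨k, rfl⟩ := h
      rw [if_pos (dvd_mul_right r k), Nat.mul_div_cancel_left _ hr, map_sum]
      simp only [map_mul]
      symm
      refine Finset.sum_bij_ne_zero (fun x _ _ => (x.1 / r, x.2 / r)) ?_ ?_ ?_ ?_
      · rintro ⟨a, b⟩ hx hne
        have ha : r ∣ a := by by_contra h; simp [h] at hne
        have hb : r ∣ b := by by_contra h; simp [h] at hne
        obtain ⟨a, rfl⟩ := ha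
        obtain ⟨b, rfl⟩ := hb
        simp only [Finset.HasAntidiagonal.mem_antidiagonal] at hx ⊢
        rw [Nat.mul_div_cancel_left _ hr, Nat.mul_div_cancel_left _ hr]
        rw [← mul_add] at hx
        exact Nat.eq_of_mul_eq_mul_left hr hx
      · rintro ⟨a, b⟩ _ hne ⟨a', b'⟩ _ hne' he
        have ha : r ∣ a := by by_contra h; simp [h] at hne
        have hb : r ∣ b := by by_contra h; simp [h] at hne
        have ha' : r ∣ a' := by by_contra h; simp [h] at hne'
        have hb' : r ∣ b' := by by_contra h; simp [h] at hne'
        simp only [Prod.mk.injEq] at he ⊢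
        rw [← Nat.mul_div_cancel' ha, ← Nat.mul_div_cancel' hb, he.1, he.2,
          Nat.mul_div_cancel' ha', Nat.mul_div_cancel' hb']
        exact ⟨rfl, rfl⟩
      · rintro ⟨a, b⟩ hx hne
        refine ⟨(r * a, r * b), ?_, ?_, ?_⟩
        · simp only [Finset.HasAntidiagonal.mem_antidiagonal] at hx ⊢
          rw [← mul_add, hx]
        · simpa [Nat.mul_div_cancel_left _ hr] using hne
        · simp [Nat.mul_div_cancel_left _ hr]
      · rintro ⟨a, b⟩ _ hne
        have ha : r ∣ a := by by_contra h; simp [h] at hne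
        have hb : r ∣ b := by by_contra h; simp [h] at hne
        simp [ha, hb]
    · rw [if_neg h]
      symm
      refine Finset.sum_eq_zero ?_
      rintro ⟨a, b⟩ hx
      simp only [Finset.HasAntidiagonal.mem_antidiagonal] at hx
      by_cases ha : r ∣ a
      · have hb : ¬ r ∣ b := fun hb => h (hx ▸ dvd_add ha hb)
        simp [hb]
      · simp [ha]

theorem coeff_expand (r : ℕ) (hr : 0 < r) (f : PowerSeries (TensorAlgebra R (⨂[R]^r M))) (k : ℕ) :
    PowerSeries.coeff k (expand R M r hr f) =
      if r ∣ k then flatten R M r (PowerSeries.coeff (k / r) f) else 0 := by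
  simp only [expand, RingHom.coe_mk, MonoidHom.coe_mk, OneHom.coe_mk, PowerSeries.coeff_mk]

/-- The homomorphism `f(t) ↦ f(t^r)` from the special units for `M^{⊗r}` to those for `M`. -/
def verUnits (r : ℕ) (hr : 0 < r) : SpecialUnits R (⨂[R]^r M) →* SpecialUnits R M :=
  ((Units.map (expand R M r hr : _ →* _)).comp (SpecialUnits R (⨂[R]^r M)).subtype).codRestrict
    (SpecialUnits R M) (by
      rintro ⟨u, hu, hu'⟩
      refine ⟨?_, fun k => ?_⟩
      · change PowerSeries.constantCoeff (expand R M r hr u) = 1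
        rw [← PowerSeries.coeff_zero_eq_constantCoeff_apply, coeff_expand, if_pos (dvd_zero r),
          Nat.zero_div, PowerSeries.coeff_zero_eq_constantCoeff_apply, hu, map_one]
      · change PowerSeries.coeff k (expand R M r hr u) ∈ _
        rw [coeff_expand]
        split_ifs with h
        · obtain ⟨k, rfl⟩ := h
          rw [Nat.mul_div_cancel_left _ hr]
          exact flatten_mem R M r k (hu' k)
        · exact zero_mem _)

theorem coeff_verUnits (r : ℕ) (hr : 0 < r) (u : SpecialUnits R (⨂[R]^r M)) (k : ℕ) :
    PowerSeries.coeff k ((verUnits R M r hr u).1 : PowerSeries (TensorAlgebra R M)) =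
      if r ∣ k then flatten R M r (PowerSeries.coeff (k / r)
        (u.1 : PowerSeries (TensorAlgebra R (⨂[R]^r M)))) else 0 :=
  coeff_expand R M r hr _ k

theorem continuous_verUnits (r : ℕ) (hr : 0 < r) : Continuous (verUnits R M r hr) := by
  let _ : TopologicalSpace (TensorAlgebra R M) := ⊥
  let _ : TopologicalSpace (TensorAlgebra R (⨂[R]^r M)) := ⊥
  have _ : DiscreteTopology (TensorAlgebra R (⨂[R]^r M)) := ⟨rfl⟩
  refine continuous_induced_rng.2 (continuous_pi fun k => ?_)
  have h : Continuous fun u : SpecialUnits R (⨂[R]^r M) =>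
      PowerSeries.coeff (k / r) (u.1 : PowerSeries (TensorAlgebra R (⨂[R]^r M))) :=
    continuous_pi_iff.1 (continuous_induced_dom (f := fun (u : SpecialUnits R (⨂[R]^r M)) (k : ℕ) =>
      PowerSeries.coeff k (u.1 : PowerSeries (TensorAlgebra R (⨂[R]^r M))))) (k / r)
  have h2 : Continuous fun a : TensorAlgebra R (⨂[R]^r M) =>
      if r ∣ k then flatten R M r a else 0 := continuous_of_discreteTopology
  refine (h2.comp h).congr fun u => ?_
  exact (coeff_verUnits R M r hr u k).symm


/-! Series in `t^l` lie in every closed subgroup that contains the series `1 - m t^{lK}` with `m` an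
elementary tensor; hence the Verschiebung is well defined on the truncated Witt vectors. -/

variable {R M}

theorem coeff_oneSub (k : ℕ) (hk : 0 < k) (a : ⨂[R]^k M) (j : ℕ) :
    PowerSeries.coeff j ((oneSub R k hk a).1 : PowerSeries (TensorAlgebra R M)) =
      (if j = 0 then 1 else 0) - if j = k then TensorPower.toTensorAlgebra a else 0 := by
  change PowerSeries.coeff j (1 - PowerSeries.monomial k (TensorPower.toTensorAlgebra a)) = _
  rw [map_sub, PowerSeries.coeff_one, PowerSeries.coeff_monomial]

theorem coeff_zero_units (u : SpecialUnits R M) :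
    PowerSeries.coeff 0 (u.1 : PowerSeries (TensorAlgebra R M)) = 1 := by
  rw [PowerSeries.coeff_zero_eq_constantCoeff_apply]; exact u.2.1

theorem coeff_mul_eq_zero {l : ℕ} {u v : SpecialUnits R M}
    (hu : ∀ j, ¬ l ∣ j → PowerSeries.coeff j (u.1 : PowerSeries (TensorAlgebra R M)) = 0)
    (hv : ∀ j, ¬ l ∣ j → PowerSeries.coeff j (v.1 : PowerSeries (TensorAlgebra R M)) = 0)
    (j : ℕ) (hj : ¬ l ∣ j) :
    PowerSeries.coeff j ((u * v).1 : PowerSeries (TensorAlgebra R M)) = 0 := by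
  change PowerSeries.coeff j (u.1.1 * v.1.1) = 0
  rw [PowerSeries.coeff_mul]
  refine Finset.sum_eq_zero ?_
  rintro ⟨a, b⟩ hx
  rw [Finset.HasAntidiagonal.mem_antidiagonal] at hx
  by_cases ha : l ∣ a
  · have hb : ¬ l ∣ b := fun hb => hj (hx ▸ dvd_add ha hb)
    simp [hv b hb]
  · simp [hu a ha]

theorem coeff_mul_of_lt {k : ℕ} {u v : SpecialUnits R M}
    (hu : ∀ j, 0 < j → j < k → PowerSeries.coeff j (u.1 : PowerSeries (TensorAlgebra R M)) = 0)
    (hk : 0 < k) :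
    PowerSeries.coeff k ((u * v).1 : PowerSeries (TensorAlgebra R M)) =
      PowerSeries.coeff k (u.1 : PowerSeries (TensorAlgebra R M)) +
      PowerSeries.coeff k (v.1 : PowerSeries (TensorAlgebra R M)) := by
  change PowerSeries.coeff k (u.1.1 * v.1.1) = _
  rw [PowerSeries.coeff_mul,
    ← Finset.add_sum_erase _ _ (a := ((0, k) : ℕ × ℕ))
      (by rw [Finset.HasAntidiagonal.mem_antidiagonal]; simp),
    ← Finset.add_sum_erase _ _ (a := ((k, 0) : ℕ × ℕ))
      (by
        rw [Finset.mem_erase, Finset.HasAntidiagonal.mem_antidiagonal]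
        exact ⟨by simp [hk.ne'], by simp⟩),
    Finset.sum_eq_zero]
  · simp only [coeff_zero_units, one_mul, mul_one, add_zero]
    exact add_comm _ _
  · rintro ⟨a, b⟩ hx
    rw [Finset.mem_erase, Finset.mem_erase, Finset.HasAntidiagonal.mem_antidiagonal] at hx
    obtain ⟨h1, h2, h3⟩ := hx
    simp only [ne_eq, Prod.mk.injEq, not_and] at h1 h2 h3
    rw [hu a (by omega) (by omega), zero_mul]

theorem exists_mem_coeff (N : Subgroup (SpecialUnits R M)) {k : ℕ} (hk : 0 < k)
    (hN : ∀ m : Fin k → M, oneSub R k hk (PiTensorProduct.tprod R m) ∈ N)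
    (c : ⨂[R]^k M) :
    ∃ g ∈ N, (∀ j, ¬ k ∣ j → PowerSeries.coeff j (g.1 : PowerSeries (TensorAlgebra R M)) = 0) ∧
      PowerSeries.coeff k (g.1 : PowerSeries (TensorAlgebra R M)) =
        TensorPower.toTensorAlgebra c := by
  induction c using PiTensorProduct.induction_on with
  | smul_tprod r m =>
    refine ⟨_, hN (Function.update m ⟨0, hk⟩ ((-r) • m ⟨0, hk⟩)), fun j hj => ?_, ?_⟩
    · rw [coeff_oneSub, if_neg, if_neg, sub_zero]
      · rintro rfl; exact hj dvd_rfl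
      · rintro rfl; exact hj (dvd_zero _)
    · rw [coeff_oneSub, if_neg hk.ne', if_pos rfl, MultilinearMap.map_update_smul,
        Function.update_eq_self, neg_smul, map_neg, zero_sub, neg_neg]
  | add a b ha hb =>
    obtain ⟨g, hg, hg1, hg2⟩ := ha
    obtain ⟨h, hh, hh1, hh2⟩ := hb
    refine ⟨g * h, mul_mem hg hh, coeff_mul_eq_zero hg1 hh1, ?_⟩
    rw [coeff_mul_of_lt (fun j hj hj' => hg1 j fun h => (Nat.le_of_dvd hj h).not_gt hj') hk, hg2,
      hh2, map_add]

theorem mem_of_supported (N : Subgroup (SpecialUnits R M)) (hc : IsClosed (N : Set (SpecialUnits R M)))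
    {l : ℕ} (hl : 0 < l)
    (hN : ∀ (K : ℕ) (hK : 0 < K) (m : Fin (l * K) → M),
      oneSub R (l * K) (Nat.mul_pos hl hK) (PiTensorProduct.tprod R m) ∈ N)
    (u : SpecialUnits R M)
    (hu : ∀ j, ¬ l ∣ j → PowerSeries.coeff j (u.1 : PowerSeries (TensorAlgebra R M)) = 0) :
    u ∈ N := by
  have key : ∀ K : ℕ, ∃ g ∈ N,
      (∀ j, ¬ l ∣ j → PowerSeries.coeff j ((u * g).1 : PowerSeries (TensorAlgebra R M)) = 0) ∧
      ∀ j, 0 < j → j < l * (K + 1) →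
        PowerSeries.coeff j ((u * g).1 : PowerSeries (TensorAlgebra R M)) = 0 := by
    intro K
    induction K with
    | zero =>
      refine ⟨1, one_mem _, by simpa using hu, fun j hj hj' => ?_⟩
      rw [mul_one]
      exact hu j fun h => (Nat.le_of_dvd hj h).not_gt (by simpa using hj')
    | succ K ih =>
      obtain ⟨g, hg, hg1, hg2⟩ := ih
      have hpos : 0 < l * (K + 1) := Nat.mul_pos hl K.succ_pos
      obtain ⟨c, hcc⟩ := (u * g).2.2 (l * (K + 1))
      obtain ⟨h, hh, hh1, hh2⟩ := exists_mem_coeff N hpos (hN (K + 1) K.succ_pos) (-c)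
      have hh3 : ∀ j, ¬ l ∣ j →
          PowerSeries.coeff j (h.1 : PowerSeries (TensorAlgebra R M)) = 0 :=
        fun j hj => hh1 j fun hd => hj ((dvd_mul_right l (K + 1)).trans hd)
      have hS := coeff_mul_eq_zero hg1 hh3
      refine ⟨g * h, mul_mem hg hh, by rwa [← mul_assoc], fun j hj hj' => ?_⟩
      rw [← mul_assoc]
      by_cases hd : l ∣ j
      · rcases lt_trichotomy j (l * (K + 1)) with hlt | rfl | hgt
        · rw [coeff_mul_of_lt (fun i hi hi' => hg2 i hi (hi'.trans hlt)) hj, hg2 j hj hlt,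
            hh1 j fun hd => (Nat.le_of_dvd hj hd).not_gt hlt, add_zero]
        · rw [coeff_mul_of_lt hg2 hj, hh2, ← hcc, map_neg, add_neg_cancel]
        · obtain ⟨q, rfl⟩ := hd
          have h1 := Nat.lt_of_mul_lt_mul_left hgt
          have h2 := Nat.lt_of_mul_lt_mul_left hj'
          omega
      · exact hS j hd
  choose g hg _ hg2 using key
  rw [← inv_mem_iff]
  refine hc.mem_of_tendsto (f := g) (b := Filter.atTop) ?_ (Filter.Eventually.of_forall hg)
  let _ : TopologicalSpace (TensorAlgebra R M) := ⊥
  refine (Topology.IsInducing.tendsto_nhds_iff ⟨rfl⟩).2 (tendsto_pi_nhds.2 fun j => ?_)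
  refine tendsto_const_nhds.congr' ?_
  filter_upwards [Filter.eventually_ge_atTop j] with K hK
  have hj : j < l * (K + 1) := by nlinarith
  have h1 : g K = u⁻¹ * (u * g K) := by rw [inv_mul_cancel_left]
  change PowerSeries.coeff j ((u⁻¹).1 : PowerSeries (TensorAlgebra R M)) =
    PowerSeries.coeff j ((g K).1 : PowerSeries (TensorAlgebra R M))
  conv_rhs => rw [h1]
  change _ = PowerSeries.coeff j ((u⁻¹).1.1 * (u * g K).1.1)
  rw [PowerSeries.coeff_mul, Finset.sum_eq_single (j, 0), coeff_zero_units, mul_one]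
  · rintro ⟨a, b⟩ hx hne
    rw [Finset.HasAntidiagonal.mem_antidiagonal] at hx
    simp only [ne_eq, Prod.mk.injEq, not_and] at hx hne
    rw [hg2 K b (by omega) (by omega), mul_zero]
  · intro h
    exact absurd (by rw [Finset.HasAntidiagonal.mem_antidiagonal]; simp) h

variable (R M)

theorem relSubgroup_le_comap (p : ℕ) [hp : Fact p.Prime] {n i : ℕ} (hi : i ≤ n) :
    relSubgroup R (⨂[R]^(p ^ i) M) p (n - i) ≤
      (relSubgroup R M p n).comap (verUnits R M (p ^ i) (pow_pos hp.out.pos i)) := by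
  have hr : 0 < p ^ i := pow_pos hp.out.pos i
  intro x hx
  rw [Subgroup.mem_comap]
  refine Subgroup.mem_sInf.2 fun N hN => ?_
  have hcl : IsClosed ((N.comap (verUnits R M (p ^ i) hr) :
      Subgroup (SpecialUnits R (⨂[R]^(p ^ i) M))) : Set (SpecialUnits R (⨂[R]^(p ^ i) M))) :=
    hN.2.1.preimage (continuous_verUnits R M (p ^ i) hr)
  have hnm := hN.1
  refine Subgroup.mem_sInf.1 hx (N.comap (verUnits R M (p ^ i) hr)) ⟨inferInstance, hcl, ?_⟩
  rintro u (⟨f, g, rfl⟩ | ⟨k, hk, m, hkp, rfl⟩)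
  · rw [SetLike.mem_coe, Subgroup.mem_comap]
    simp only [map_mul, map_inv]
    exact hN.2.2 (Or.inl ⟨_, _, rfl⟩)
  · rw [SetLike.mem_coe, Subgroup.mem_comap]
    refine mem_of_supported N hN.2.1 (Nat.mul_pos hr hk) (fun K hK m' => ?_) _ fun j hj => ?_
    · refine hN.2.2 (Or.inr ⟨_, Nat.mul_pos (Nat.mul_pos hr hk) hK, m', fun a ha he => ?_, rfl⟩)
      have hd : p ^ i * k ∣ p ^ a := ⟨K, he.symm⟩
      obtain ⟨b, hb, hb'⟩ := (Nat.dvd_prime_pow hp.out).1 hd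
      have hib : i ≤ b := (Nat.pow_dvd_pow_iff_le_right hp.out.one_lt).1 ⟨k, hb'.symm⟩
      refine hkp (b - i) (by omega) (Nat.eq_of_mul_eq_mul_left hr ?_)
      rw [hb', ← pow_add, Nat.add_sub_cancel' hib]
    · rw [coeff_verUnits]
      split_ifs with h
      · obtain ⟨q, rfl⟩ := h
        rw [Nat.mul_div_cancel_left _ hr, coeff_oneSub, if_neg, if_neg, sub_zero, map_zero]
        · rintro rfl; exact hj dvd_rfl
        · rintro rfl; exact hj (by simp)
      · rfl

variable {M}

/-- The iterated Verschiebung `V^i : W_{⟨p^{n-i}⟩}(R; M^{⊗p^i}) → W_{⟨p^n⟩}(R; M)`, induced by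
`f(t) ↦ f(t^{p^i})`, the `i`-fold iterate of `t ↦ t^p`. -/
def ver (p : ℕ) [hp : Fact p.Prime] {n i : ℕ} (hi : i ≤ n) :
    W R (⨂[R]^(p ^ i) M) p (n - i) →+ W R M p n :=
  MonoidHom.toAdditive (QuotientGroup.map _ _ (verUnits R M (p ^ i) (pow_pos hp.out.pos i))
    (relSubgroup_le_comap R M p hi))

/-! ### Witt coordinates and ghost components -/

/-- The class of `∏_{i=0}^n (1 - m_i t^{p^i})`. -/
def wittCoord (p : ℕ) [hp : Fact p.Prime] (n : ℕ) (m : ∀ i : Fin (n + 1), ⨂[R]^(p ^ (i : ℕ)) M) :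
    W R M p n :=
  ∑ i : Fin (n + 1), W.mk R p n (oneSub R (p ^ (i : ℕ)) (pow_pos hp.out.pos _) (m i))

variable {R}

/-- The generator of the cyclic group `C_k` acting on `M^{⊗k}` by cyclic permutation of the tensor
factors. -/
def rot (k : ℕ) : (⨂[R]^k M) ≃ₗ[R] ⨂[R]^k M :=
  PiTensorProduct.reindex R (fun _ => M) (finRotate k)

/-- For `i ≤ j`, the tensor power `a ↦ a^{⊗p^{j-i}} : M^{⊗p^i} → M^{⊗p^j}`. -/
def tensPow (p : ℕ) {i j : ℕ} (hij : i ≤ j) (a : ⨂[R]^(p ^ i) M) : ⨂[R]^(p ^ j) M :=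
  TensorPower.cast R M (by rw [smul_eq_mul, ← pow_add, Nat.sub_add_cancel hij])
    (GradedMonoid.GMonoid.gnpow (A := fun k => ⨂[R]^k M) (p ^ (j - i)) a)

/-- The `j`-th ghost component
`w_j(m_0, …, m_n) = ∑_{i ≤ j} ∑_{σ ∈ C_{p^j}/C_{p^{j-i}}} σ (m_i^{⊗p^{j-i}})`. The generator of
`C_{p^j}` being `rot`, the cosets of `C_{p^{j-i}}` are represented by `rot^s` with `s < p^i`. -/
def ghost (p n j : ℕ) (m : ∀ i : Fin (n + 1), ⨂[R]^(p ^ (i : ℕ)) M) : ⨂[R]^(p ^ j) M :=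
  ∑ i : Fin (n + 1), if h : (i : ℕ) ≤ j then
    ∑ s ∈ Finset.range (p ^ (i : ℕ)), (rot (p ^ j) ^ s) (tensPow p h (m i)) else 0

end Series

/-! ### The monoidal structure map -/

section Monoidal

variable {R : Type*} [CommRing R] {M : Type*} [AddCommGroup M] [Module R M]
  {N : Type*} [AddCommGroup N] [Module R N]

/-- The map `M^{⊗k} × N^{⊗k} → (M ⊗ N)^{⊗k}` that sends `(m₁ ⊗ ⋯ ⊗ m_k, n₁ ⊗ ⋯ ⊗ n_k)` to
`(m₁ ⊗ n₁) ⊗ ⋯ ⊗ (m_k ⊗ n_k)`. -/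
def shuffle (k : ℕ) : (⨂[R]^k M) →ₗ[R] (⨂[R]^k N) →ₗ[R] ⨂[R]^k (M ⊗[R] N) :=
  PiTensorProduct.map₂ fun _ => TensorProduct.mk R M N

variable (R M N) in
/-- Biadditive maps `W_{⟨p^n⟩}(R; M) × W_{⟨p^n⟩}(R; N) → W_{⟨p^n⟩}(R; M ⊗ N)`. -/
abbrev Pairing (p n : ℕ) : Type _ :=
  W R M p n →+ W R N p n →+ W R (M ⊗[R] N) p n

/-- The ghost components are monoidal for the given biadditive map: `w_j(a ⋆ b) = w_j(a) ⊗ w_j(b)`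
for `0 ≤ j ≤ n`, in terms of any Witt coordinates of `a`, `b` and `a ⋆ b`. For `R = ℤ` and free abelian groups `M` and `N` exactly one biadditive map has this
property: the structure map of the lax monoidal functor `W_{⟨p^n⟩}`. -/
def IsMonoidalProduct (p : ℕ) [Fact p.Prime] (n : ℕ) (star : Pairing R M N p n) : Prop :=
  ∀ (a : ∀ i : Fin (n + 1), ⨂[R]^(p ^ (i : ℕ)) M) (b : ∀ i : Fin (n + 1), ⨂[R]^(p ^ (i : ℕ)) N)
    (c : ∀ i : Fin (n + 1), ⨂[R]^(p ^ (i : ℕ)) (M ⊗[R] N)),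
    star (wittCoord R p n a) (wittCoord R p n b) = wittCoord R p n c →
    ∀ j ≤ n, ghost p n j c = shuffle (p ^ j) (ghost p n j a) (ghost p n j b)

end Monoidal

/-! ### Words and cyclic words -/

/-- The elementary tensor `x₁ ⊗ ⋯ ⊗ x_k` in `ℤ(X)^{⊗k}`. -/
def word {X : Type*} {k : ℕ} (x : Fin k → X) : ⨂[ℤ]^k (X →₀ ℤ) :=
  PiTensorProduct.tprod ℤ fun l => Finsupp.single (x l) 1

/-- Two words are related if they differ by a cyclic permutation. -/
def cyclicSetoid (X : Type*) (k : ℕ) : Setoid (Fin k → X) where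
  r x y := ∃ σ ∈ Subgroup.zpowers (finRotate k), y = x ∘ σ
  iseqv :=
    { refl := fun x => ⟨1, one_mem _, rfl⟩
      symm := by
        rintro x y ⟨σ, hσ, rfl⟩
        exact ⟨σ⁻¹, inv_mem hσ, by ext l; simp⟩
      trans := by
        rintro x y z ⟨σ, hσ, rfl⟩ ⟨τ, hτ, rfl⟩
        exact ⟨σ * τ, mul_mem hσ hτ, rfl⟩ }

/-- The element `V^i τ(x₁ ⊗ ⋯ ⊗ x_{p^i})` of `W_{⟨p^n⟩}(ℤ; ℤ(X))`. -/
def gen {X : Type*} (p : ℕ) [Fact p.Prime] {n i : ℕ} (hi : i ≤ n) (x : Fin (p ^ i) → X) :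
    W ℤ (X →₀ ℤ) p n :=
  ver ℤ p hi (teich ℤ p (n - i) (word x))

end WittCoeff

end

open WittCoeff

open scoped TensorProduct

noncomputable section

namespace WittCoeff

/-! ### Tensor powers and cyclic permutations -/

section Tensor

variable {R : Type*} [CommRing R] {M : Type*} [AddCommGroup M] [Module R M]

/-- The projection of the tensor algebra onto its homogeneous component of degree `k`. -/
def component (k : ℕ) : TensorAlgebra R M →ₗ[R] ⨂[R]^k M :=
  DirectSum.component R ℕ (fun k => ⨂[R]^k M) k ∘ₗ TensorAlgebra.toDirectSum.toLinearMap

theorem toDirectSum_toTensorAlgebra {k : ℕ} (a : ⨂[R]^k M) :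
    TensorAlgebra.toDirectSum (TensorPower.toTensorAlgebra a) =
      DirectSum.lof R ℕ (fun k => ⨂[R]^k M) k a := by
  induction a using PiTensorProduct.induction_on with
  | smul_tprod r x =>
    rw [map_smul, map_smul, map_smul, TensorPower.toTensorAlgebra_tprod,
      TensorAlgebra.toDirectSum_tensorPower_tprod, DirectSum.lof_eq_of]
  | add a b ha hb => rw [map_add, map_add, map_add, ha, hb]

theorem component_toTensorAlgebra {k : ℕ} (a : ⨂[R]^k M) :
    component k (TensorPower.toTensorAlgebra a) = a := by
  simp [component, toDirectSum_toTensorAlgebra]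

theorem component_toTensorAlgebra_of_ne {j k : ℕ} (h : j ≠ k) (a : ⨂[R]^j M) :
    component k (TensorPower.toTensorAlgebra a) = 0 := by
  simp only [component, LinearMap.comp_apply, AlgHom.toLinearMap_apply,
    toDirectSum_toTensorAlgebra]
  exact DirectSum.component.of R _ _ _ |>.trans (dif_neg h)

theorem component_of_mem_deg {j k : ℕ} (h : j ≠ k) {a : TensorAlgebra R M} (ha : a ∈ deg R M j) :
    component k a = 0 := by
  obtain ⟨a, rfl⟩ := ha
  exact component_toTensorAlgebra_of_ne h a

theorem toTensorAlgebra_injective (k : ℕ) :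
    Function.Injective (TensorPower.toTensorAlgebra : (⨂[R]^k M) →ₗ[R] TensorAlgebra R M) :=
  fun a b h => by rw [← component_toTensorAlgebra a, h, component_toTensorAlgebra]

theorem toTensorAlgebra_cast {i j : ℕ} (h : i = j) (a : ⨂[R]^i M) :
    TensorPower.toTensorAlgebra (TensorPower.cast R M h a) = TensorPower.toTensorAlgebra a := by
  subst h
  simp

theorem val_finRotate_pow (k s : ℕ) (l : Fin k) :
    (((finRotate k) ^ s) l : ℕ) = (l + s) % k := by
  induction s with
  | zero => simp [Nat.mod_eq_of_lt l.2]
  | succ s ih =>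
    rw [pow_succ', Equiv.Perm.mul_apply]
    obtain ⟨k, rfl⟩ : ∃ k', k = k' + 1 := ⟨k - 1, by have := l.2; omega⟩
    generalize ((finRotate (k + 1)) ^ s) l = m at ih
    rcases Nat.lt_or_ge m.1 k with h | h
    · have h1 : finRotate (k + 1) m = ⟨m.1 + 1, by omega⟩ := finRotate_of_lt h
      rw [h1, ← add_assoc, Nat.add_mod, ← ih, Nat.add_mod_mod, Nat.mod_eq_of_lt (by omega)]
    · have h0 := m.2
      have h1 : m = Fin.last k := Fin.ext (by simp; omega)
      rw [← add_assoc, Nat.add_mod, ← ih, Nat.add_mod_mod, h1, finRotate_last]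
      simp

theorem rot_pow_tprod (k s : ℕ) (f : Fin k → M) :
    (rot (R := R) k ^ s) (PiTensorProduct.tprod R (f ∘ ⇑(finRotate k ^ s))) =
      PiTensorProduct.tprod R f := by
  induction s generalizing f with
  | zero => simp
  | succ s ih =>
    have h : f ∘ ⇑(finRotate k ^ (s + 1)) = (f ∘ finRotate k) ∘ ⇑(finRotate k ^ s) := by
      ext l; simp [pow_succ']
    rw [pow_succ', LinearEquiv.mul_apply, h, ih, rot, PiTensorProduct.reindex_tprod]
    exact congrArg _ (funext fun l => congrArg f ((finRotate k).apply_symm_apply l))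

theorem rot_pow_self (k : ℕ) : (rot k : (⨂[R]^k M) ≃ₗ[R] ⨂[R]^k M) ^ k = 1 := by
  have h : finRotate k ^ k = 1 := by
    ext l
    rw [val_finRotate_pow, Nat.add_mod_right, Nat.mod_eq_of_lt l.2, Equiv.Perm.one_apply]
  ext a
  induction a using PiTensorProduct.induction_on with
  | smul_tprod r x =>
    rw [map_smul, map_smul]
    congr 1
    conv_lhs => rw [← Function.comp_id x, ← Equiv.Perm.coe_one, ← h]
    exact rot_pow_tprod (R := R) k k x
  | add a b ha hb => rw [map_add, ha, hb, map_add]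

theorem toTensorAlgebra_tprod_mul {r s : ℕ} (f : Fin r → M) (g : Fin s → M) :
    TensorPower.toTensorAlgebra (PiTensorProduct.tprod R f) *
      TensorPower.toTensorAlgebra (PiTensorProduct.tprod R g) =
      TensorPower.toTensorAlgebra (PiTensorProduct.tprod R (Fin.append f g)) := by
  rw [← TensorPower.toTensorAlgebra_gMul, TensorPower.tprod_mul_tprod]

theorem append_comp_finRotate_pow {α : Type*} {r s : ℕ} (f : Fin r → α) (g : Fin s → α) :
    (Fin.append g f ∘ Fin.cast (add_comm r s)) ∘ ⇑(finRotate (r + s) ^ s) = Fin.append f g := by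
  ext l
  simp only [Function.comp_apply]
  refine Fin.addCases (fun l => ?_) (fun l => ?_) l
  · rw [Fin.append_left]
    convert Fin.append_right g f l
    ext
    simp only [Fin.val_cast, val_finRotate_pow, Fin.val_castAdd, Fin.val_natAdd]
    rw [Nat.mod_eq_of_lt (by omega), add_comm]
  · rw [Fin.append_right]
    convert Fin.append_left g f l
    ext
    simp only [Fin.val_cast, val_finRotate_pow, Fin.val_castAdd, Fin.val_natAdd]
    rw [show r + l + s = l + (r + s) by omega, Nat.add_mod_right, Nat.mod_eq_of_lt (by omega)]

theorem rot_pow_component_mul {r s : ℕ} (a : ⨂[R]^r M) (b : ⨂[R]^s M) :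
    (rot (r + s) ^ s) (component (r + s)
      (TensorPower.toTensorAlgebra a * TensorPower.toTensorAlgebra b)) =
    component (r + s) (TensorPower.toTensorAlgebra b * TensorPower.toTensorAlgebra a) := by
  induction a using PiTensorProduct.induction_on with
  | smul_tprod c f =>
    induction b using PiTensorProduct.induction_on with
    | smul_tprod d g =>
      simp only [map_smul, smul_mul_assoc, mul_smul_comm]
      rw [smul_comm]
      congr 2
      rw [toTensorAlgebra_tprod_mul, toTensorAlgebra_tprod_mul, component_toTensorAlgebra,
        ← toTensorAlgebra_cast (add_comm s r), component_toTensorAlgebra, TensorPower.cast_tprod,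
        ← append_comp_finRotate_pow f g]
      exact rot_pow_tprod (R := R) _ _ _
    | add a b ha hb => simp only [map_add, mul_add, add_mul, ha, hb]
  | add a b ha hb => simp only [map_add, mul_add, add_mul, ha, hb]

/-- The norm `∑_{σ ∈ C_k} σ` on `M^{⊗k}`. -/
def cyclicNorm (k : ℕ) : (⨂[R]^k M) →ₗ[R] ⨂[R]^k M :=
  ∑ s ∈ Finset.range k, ((rot k ^ s : (⨂[R]^k M) ≃ₗ[R] ⨂[R]^k M) : (⨂[R]^k M) →ₗ[R] ⨂[R]^k M)

theorem cyclicNorm_apply (k : ℕ) (a : ⨂[R]^k M) :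
    cyclicNorm k a = ∑ s ∈ Finset.range k, (rot k ^ s) a := by
  simp [cyclicNorm]

theorem sum_range_rot_pow_add (q : ℕ) {k : ℕ} {a : ⨂[R]^k M} (h : (rot k ^ q) a = a) (t : ℕ) :
    ∑ s ∈ Finset.range q, (rot k ^ (s + t)) a = ∑ s ∈ Finset.range q, (rot k ^ s) a := by
  induction t with
  | zero => rfl
  | succ t ih =>
    rw [← ih]
    have h1 := Finset.sum_range_succ (fun s => (rot k ^ (s + t)) a) q
    rw [Finset.sum_range_succ'] at h1
    have h2 : (rot k ^ (q + t)) a = (rot k ^ (0 + t)) a := by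
      rw [add_comm q t, pow_add, LinearEquiv.mul_apply, h, zero_add]
    rw [h2] at h1
    rw [← add_right_cancel h1]
    exact Finset.sum_congr rfl fun s _ => by rw [add_right_comm, add_assoc]

theorem cyclicNorm_rot_pow (k t : ℕ) (a : ⨂[R]^k M) :
    cyclicNorm k ((rot k ^ t) a) = cyclicNorm k a := by
  rw [cyclicNorm_apply, cyclicNorm_apply,
    ← sum_range_rot_pow_add (a := a) k (by rw [rot_pow_self]; rfl) t]
  simp only [pow_add, LinearEquiv.mul_apply]

theorem cyclicNorm_of_rot_pow_eq {q d : ℕ} {k : ℕ} (hk : k = d * q) {a : ⨂[R]^k M}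
    (h : (rot k ^ q) a = a) :
    cyclicNorm k a = d • ∑ s ∈ Finset.range q, (rot k ^ s) a := by
  rw [cyclicNorm_apply]
  have : ∀ e, ∑ s ∈ Finset.range (e * q), (rot k ^ s) a =
      e • ∑ s ∈ Finset.range q, (rot k ^ s) a := by
    intro e
    induction e with
    | zero => simp
    | succ e ih =>
      rw [add_mul, one_mul, Finset.sum_range_add, ih, succ_nsmul]
      congr 1
      rw [← sum_range_rot_pow_add q h (e * q)]
      exact Finset.sum_congr rfl fun s _ => by rw [add_comm]
  rw [← this, ← hk]

/-- The norm of the component of degree `k`, a trace on the tensor algebra. -/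
def cyclicTrace (k : ℕ) : TensorAlgebra R M →ₗ[R] ⨂[R]^k M :=
  cyclicNorm k ∘ₗ component k

theorem cyclicTrace_mul_comm (k : ℕ) {r s : ℕ} {a b : TensorAlgebra R M} (ha : a ∈ deg R M r)
    (hb : b ∈ deg R M s) : cyclicTrace k (a * b) = cyclicTrace k (b * a) := by
  simp only [cyclicTrace, LinearMap.comp_apply]
  by_cases h : r + s = k
  · subst h
    obtain ⟨a, rfl⟩ := ha
    obtain ⟨b, rfl⟩ := hb
    rw [← rot_pow_component_mul, cyclicNorm_rot_pow]
  · rw [component_of_mem_deg h (mul_mem_deg ha hb),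
      component_of_mem_deg (by omega) (mul_mem_deg hb ha)]

theorem toTensorAlgebra_gnpow {k : ℕ} (q : ℕ) (a : ⨂[R]^k M) :
    TensorPower.toTensorAlgebra (GradedMonoid.GMonoid.gnpow (A := fun k => ⨂[R]^k M) q a) =
      TensorPower.toTensorAlgebra a ^ q := by
  have h : ∀ x y : GradedMonoid fun k => ⨂[R]^k M, x = y →
      TensorPower.toTensorAlgebra x.2 = TensorPower.toTensorAlgebra y.2 := by
    rintro x y rfl; rfl
  induction q with
  | zero =>
    rw [pow_zero, ← TensorPower.toTensorAlgebra_gOne]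
    exact h _ _ (GradedMonoid.GMonoid.gnpow_zero' (A := fun k => ⨂[R]^k M) ⟨k, a⟩)
  | succ q ih =>
    rw [pow_succ, ← ih, ← TensorPower.toTensorAlgebra_gMul]
    exact h _ _ (GradedMonoid.GMonoid.gnpow_succ' (A := fun k => ⨂[R]^k M) q ⟨k, a⟩)

theorem toTensorAlgebra_tensPow (p : ℕ) {i j : ℕ} (hij : i ≤ j) (a : ⨂[R]^(p ^ i) M) :
    TensorPower.toTensorAlgebra (tensPow p hij a) =
      TensorPower.toTensorAlgebra a ^ p ^ (j - i) := by
  rw [tensPow, toTensorAlgebra_cast, toTensorAlgebra_gnpow]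

theorem rot_pow_tensPow {p : ℕ} (hp : 0 < p) {i j : ℕ} (hij : i ≤ j) (a : ⨂[R]^(p ^ i) M) :
    (rot (p ^ j) ^ p ^ i) (tensPow p hij a) = tensPow p hij a := by
  obtain ⟨q, hq⟩ : ∃ q, p ^ (j - i) = q + 1 := ⟨_, (Nat.succ_pred (pow_pos hp _).ne').symm⟩
  have hN : p ^ j = q * p ^ i + p ^ i := by
    rw [← Nat.succ_mul, Nat.succ_eq_add_one, ← hq, ← pow_add, Nat.sub_add_cancel hij]
  have h1 := rot_pow_component_mul (GradedMonoid.GMonoid.gnpow (A := fun k => ⨂[R]^k M) q a) a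
  rw [toTensorAlgebra_gnpow, ← pow_succ, ← pow_succ', ← hq, ← toTensorAlgebra_tensPow p hij,
    smul_eq_mul, ← hN, component_toTensorAlgebra] at h1
  exact h1

theorem cyclicTrace_toTensorAlgebra_pow {p : ℕ} (hp : 0 < p) {i j : ℕ} (hij : i ≤ j)
    (a : ⨂[R]^(p ^ i) M) :
    cyclicTrace (p ^ j) (TensorPower.toTensorAlgebra a ^ p ^ (j - i)) =
      p ^ (j - i) • ∑ s ∈ Finset.range (p ^ i), (rot (p ^ j) ^ s) (tensPow p hij a) := by
  rw [← toTensorAlgebra_tensPow p hij, cyclicTrace, LinearMap.comp_apply,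
    component_toTensorAlgebra]
  exact cyclicNorm_of_rot_pow_eq (by rw [← pow_add, Nat.sub_add_cancel hij])
    (rot_pow_tensPow hp hij a)

/-- The elementary tensor `F 0 ⊗ ⋯ ⊗ F (k - 1)`. -/
def seqTensor (R : Type*) [CommRing R] {M : Type*} [AddCommGroup M] [Module R M] (k : ℕ)
    (F : ℤ → M) : ⨂[R]^k M :=
  PiTensorProduct.tprod R fun l : Fin k => F l

theorem exists_eq_seqTensor {k : ℕ} (hk : 0 < k) (f : Fin k → M) :
    ∃ F : ℤ → M, Function.Periodic F (k : ℤ) ∧ PiTensorProduct.tprod R f = seqTensor R k F := by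
  have hk' : (0 : ℤ) < k := by exact_mod_cast hk
  refine ⟨fun z => f ⟨(z % k).toNat, ?_⟩, fun z => by simp, ?_⟩
  · have := Int.emod_lt_of_pos z hk'
    have := Int.emod_nonneg z hk'.ne'
    omega
  · rw [seqTensor]
    congr 1
    ext l
    congr 1
    ext
    have : ((l : ℤ) % k) = l := Int.emod_eq_of_lt (by omega) (by exact_mod_cast l.2)
    simp [this]

theorem periodic_mul_nat {α : Type*} {F : ℤ → α} {c d : ℕ} (h : Function.Periodic F (c : ℤ))
    (hd : c ∣ d) : Function.Periodic F (d : ℤ) := by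
  obtain ⟨e, rfl⟩ := hd
  have := h.nat_mul e
  rwa [mul_comm, Nat.cast_mul]

theorem rot_pow_seqTensor {k : ℕ} {F : ℤ → M} (hF : Function.Periodic F (k : ℤ)) (s : ℕ) :
    (rot k ^ s) (seqTensor R k F) = seqTensor R k fun z => F (z - s) := by
  rw [seqTensor, seqTensor, ← rot_pow_tprod k s fun l : Fin k => F ((l : ℤ) - s)]
  refine congrArg _ (congrArg _ (funext fun l => ?_))
  simp only [Function.comp_apply, val_finRotate_pow]
  have h := Int.emod_add_mul_ediv ((l : ℤ) + s) k
  rw [show (((l + s) % k : ℕ) : ℤ) - s = l - (k : ℤ) * (((l : ℤ) + s) / k) by push_cast; linarith,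
    mul_comm]
  exact (hF.sub_int_mul_eq _).symm

theorem toTensorAlgebra_seqTensor (k : ℕ) (F : ℤ → M) :
    TensorPower.toTensorAlgebra (seqTensor R k F) =
      ((List.range k).map fun l : ℕ => TensorAlgebra.ι R (F l)).prod := by
  rw [seqTensor, TensorPower.toTensorAlgebra_tprod, TensorAlgebra.tprod_apply]
  congr 1
  refine List.ext_getElem (by simp) fun l h1 h2 => by simp

theorem toTensorAlgebra_seqTensor_pow {k : ℕ} {F : ℤ → M} (hF : Function.Periodic F (k : ℤ))
    (q : ℕ) :
    TensorPower.toTensorAlgebra (seqTensor R k F) ^ q =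
      TensorPower.toTensorAlgebra (seqTensor R (q * k) F) := by
  induction q with
  | zero => simp [toTensorAlgebra_seqTensor]
  | succ q ih =>
    rw [pow_succ, ih, add_mul, one_mul, toTensorAlgebra_seqTensor, toTensorAlgebra_seqTensor,
      toTensorAlgebra_seqTensor, List.range_add, List.map_append, List.prod_append, List.map_map]
    congr 3
    ext l
    simp only [Function.comp_apply]
    congr 1
    have := hF.nat_mul q l
    push_cast
    rw [add_comm, this]

theorem tensPow_seqTensor (p : ℕ) {i j : ℕ} (hij : i ≤ j) {F : ℤ → M}
    (hF : Function.Periodic F ((p ^ i : ℕ) : ℤ)) :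
    tensPow p hij (seqTensor R (p ^ i) F) = seqTensor R (p ^ j) F := by
  apply toTensorAlgebra_injective
  rw [toTensorAlgebra_tensPow, toTensorAlgebra_seqTensor_pow hF, ← pow_add,
    Nat.sub_add_cancel hij]

end Tensor

/-! ### The filtration of the special units and its closed subgroups -/

section Filtration

theorem coeff_mul_congr {A : Type*} [Semiring A] {K : ℕ} (u : PowerSeries A) {v w : PowerSeries A}
    (h : ∀ j ≤ K, PowerSeries.coeff j v = PowerSeries.coeff j w) (j : ℕ) (hj : j ≤ K) :
    PowerSeries.coeff j (u * v) = PowerSeries.coeff j (u * w) := by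
  rw [PowerSeries.coeff_mul, PowerSeries.coeff_mul]
  refine Finset.sum_congr rfl fun x hx => ?_
  rw [Finset.HasAntidiagonal.mem_antidiagonal] at hx
  rw [h _ (by omega)]

variable {R : Type*} [CommRing R] {M : Type*} [AddCommGroup M] [Module R M]

variable (R M) in
/-- The subgroup of the special units that are congruent to `1` modulo `t^{K+1}`. -/
def filtration (K : ℕ) : Subgroup (SpecialUnits R M) where
  carrier := {u | ∀ j, 0 < j → j ≤ K →
    PowerSeries.coeff j (u.1 : PowerSeries (TensorAlgebra R M)) = 0}
  one_mem' j hj _ := (PowerSeries.coeff_one j).trans (if_neg hj.ne')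
  mul_mem' {u v} hu hv j hj hjK := by
    rw [coeff_mul_of_lt (fun i hi hij => hu i hi (hij.le.trans hjK)) hj, hu j hj hjK, hv j hj hjK,
      add_zero]
  inv_mem' {u} hu j hj hjK := by
    have h := coeff_mul_of_lt (u := u) (v := u⁻¹) (fun i hi hij => hu i hi (hij.le.trans hjK)) hj
    rw [hu j hj hjK, zero_add, mul_inv_cancel] at h
    rw [← h]
    exact (PowerSeries.coeff_one j).trans (if_neg hj.ne')

theorem inv_mul_mem_filtration {K : ℕ} {u v : SpecialUnits R M}
    (h : ∀ j ≤ K, PowerSeries.coeff j (v.1 : PowerSeries (TensorAlgebra R M)) =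
      PowerSeries.coeff j (u.1 : PowerSeries (TensorAlgebra R M))) :
    u⁻¹ * v ∈ filtration R M K := by
  intro j hj hjK
  have h1 := coeff_mul_congr (u⁻¹).1.1 h j hjK
  refine h1.trans ?_
  change PowerSeries.coeff j ((u⁻¹ * u).1 : PowerSeries (TensorAlgebra R M)) = 0
  rw [inv_mul_cancel]
  exact (PowerSeries.coeff_one j).trans (if_neg hj.ne')

theorem isClosed_iff_forall_coeff {S : Set (SpecialUnits R M)} :
    IsClosed S ↔ ∀ u, (∀ K, ∃ v ∈ S, ∀ j ≤ K,
      PowerSeries.coeff j (v.1 : PowerSeries (TensorAlgebra R M)) =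
        PowerSeries.coeff j (u.1 : PowerSeries (TensorAlgebra R M))) → u ∈ S := by
  let _ : TopologicalSpace (TensorAlgebra R M) := ⊥
  have _ : DiscreteTopology (TensorAlgebra R M) := ⟨rfl⟩
  constructor
  · intro hS u hu
    choose v hv hvu using hu
    refine hS.mem_of_tendsto (f := v) (b := Filter.atTop) ?_ (Filter.Eventually.of_forall hv)
    refine (Topology.IsInducing.tendsto_nhds_iff ⟨rfl⟩).2 (tendsto_pi_nhds.2 fun j => ?_)
    refine tendsto_const_nhds.congr' ?_
    filter_upwards [Filter.eventually_ge_atTop j] with K hK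
    exact (hvu K j hK).symm
  · intro h
    refine isClosed_of_closure_subset fun u hu => h u fun K => ?_
    have hcont (j : ℕ) : Continuous fun v : SpecialUnits R M =>
        PowerSeries.coeff j (v.1 : PowerSeries (TensorAlgebra R M)) :=
      continuous_pi_iff.1 (continuous_induced_dom (f := fun (v : SpecialUnits R M) (j : ℕ) =>
        PowerSeries.coeff j (v.1 : PowerSeries (TensorAlgebra R M)))) j
    have ho : IsOpen (⋂ j ∈ Set.Iic K, {v : SpecialUnits R M |
        PowerSeries.coeff j (v.1 : PowerSeries (TensorAlgebra R M)) =
          PowerSeries.coeff j (u.1 : PowerSeries (TensorAlgebra R M))}) :=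
      (Set.finite_Iic K).isOpen_biInter fun j _ =>
        (isOpen_discrete {PowerSeries.coeff j (u.1 : PowerSeries (TensorAlgebra R M))}).preimage
          (hcont j)
    obtain ⟨v, hv, hvS⟩ := mem_closure_iff.1 hu _ ho (by simp)
    exact ⟨v, hvS, by simpa using hv⟩

theorem isClosed_of_filtration_le (N : Subgroup (SpecialUnits R M)) {K : ℕ}
    (h : filtration R M K ≤ N) : IsClosed (N : Set (SpecialUnits R M)) :=
  isClosed_iff_forall_coeff.2 fun u hu => by
    obtain ⟨v, hv, hvu⟩ := hu K
    have h1 := h (inv_mul_mem_filtration hvu)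
    have h2 := N.mul_mem h1 (N.inv_mem hv)
    rwa [mul_inv_cancel_right, inv_mem_iff] at h2

theorem filtration_le_of_isClosed (N : Subgroup (SpecialUnits R M))
    (hN : IsClosed (N : Set (SpecialUnits R M))) {K : ℕ}
    (h : ∀ k, K < k → ∀ c : ⨂[R]^k M, ∃ g ∈ N, g ∈ filtration R M (k - 1) ∧
      PowerSeries.coeff k (g.1 : PowerSeries (TensorAlgebra R M)) =
        TensorPower.toTensorAlgebra c) : filtration R M K ≤ N := by
  intro u hu
  refine isClosed_iff_forall_coeff.1 hN u fun L => ?_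
  induction L with
  | zero =>
    refine ⟨1, N.one_mem, fun j hj => ?_⟩
    rw [Nat.le_zero.1 hj, coeff_zero_units, coeff_zero_units]
  | succ L ih =>
    by_cases hL : L + 1 ≤ K
    · refine ⟨1, N.one_mem, fun j hj => ?_⟩
      rcases Nat.eq_zero_or_pos j with rfl | hj'
      · rw [coeff_zero_units, coeff_zero_units]
      · rw [hu j hj' (hj.trans hL)]
        exact (PowerSeries.coeff_one j).trans (if_neg hj'.ne')
    · obtain ⟨v, hv, hvu⟩ := ih
      have hF := inv_mul_mem_filtration fun j hj => (hvu j hj).symm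
      obtain ⟨c, hc⟩ := (v⁻¹ * u).2.2 (L + 1)
      obtain ⟨g, hg, hgF, hgc⟩ := h (L + 1) (not_le.1 hL) c
      refine ⟨v * g, mul_mem hv hg, fun j hj => ?_⟩
      have h1 : ∀ j ≤ L + 1, PowerSeries.coeff j (g.1 : PowerSeries (TensorAlgebra R M)) =
          PowerSeries.coeff j ((v⁻¹ * u).1 : PowerSeries (TensorAlgebra R M)) := by
        intro j hj
        rcases Nat.eq_zero_or_pos j with rfl | hj'
        · rw [coeff_zero_units, coeff_zero_units]
        · rcases Nat.lt_or_ge L j with h2 | h2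
          · rw [le_antisymm hj h2, hgc, hc]
          · rw [hF j hj' h2, hgF j hj' h2]
      have h2 := coeff_mul_congr v.1.1 h1 j hj
      refine h2.trans ?_
      change PowerSeries.coeff j ((v * (v⁻¹ * u)).1 : PowerSeries (TensorAlgebra R M)) = _
      rw [mul_inv_cancel_left]

theorem oneSub_mem_filtration {k : ℕ} (hk : 0 < k) (c : ⨂[R]^k M) :
    oneSub R k hk c ∈ filtration R M (k - 1) := fun j hj hjk => by
  rw [coeff_oneSub, if_neg hj.ne', if_neg (by omega), sub_zero]

theorem exists_mem_filtration (N : Subgroup (SpecialUnits R M)) {k : ℕ} (hk : 0 < k)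
    (hN : ∀ m : Fin k → M, oneSub R k hk (PiTensorProduct.tprod R m) ∈ N)
    (c : ⨂[R]^k M) :
    ∃ g ∈ N, g ∈ filtration R M (k - 1) ∧
      PowerSeries.coeff k (g.1 : PowerSeries (TensorAlgebra R M)) =
        TensorPower.toTensorAlgebra c := by
  obtain ⟨g, hg, h1, h2⟩ := exists_mem_coeff N hk hN c
  exact ⟨g, hg, fun j hj hjk => h1 j fun hd => by have := Nat.le_of_dvd hj hd; omega, h2⟩

theorem exists_mem_relSubgroup (p n : ℕ) {k : ℕ} (hk : 0 < k) (hkp : ∀ i ≤ n, k ≠ p ^ i)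
    (c : ⨂[R]^k M) :
    ∃ g ∈ relSubgroup R M p n, g ∈ filtration R M (k - 1) ∧
      PowerSeries.coeff k (g.1 : PowerSeries (TensorAlgebra R M)) =
        TensorPower.toTensorAlgebra c :=
  exists_mem_filtration _ hk (fun m => relators_subset R M p n (Or.inr ⟨k, hk, m, hkp, rfl⟩)) c

theorem isClosed_relSubgroup (p n : ℕ) :
    IsClosed (relSubgroup R M p n : Set (SpecialUnits R M)) := by
  rw [relSubgroup, Subgroup.coe_sInf]
  exact isClosed_biInter fun N hN => hN.2.1

theorem filtration_le_relSubgroup (p n : ℕ) (hp : 1 < p) :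
    filtration R M (p ^ n) ≤ relSubgroup R M p n :=
  filtration_le_of_isClosed _ (isClosed_relSubgroup p n) fun k hk c =>
    exists_mem_relSubgroup p n (by omega)
      (fun i hi h => by have := Nat.pow_le_pow_right hp.le hi; omega) c

theorem inv_mul_mem_filtration_of_coeff_eq {k : ℕ} {g u : SpecialUnits R M}
    (hg : g ∈ filtration R M (k - 1)) (hu : u ∈ filtration R M (k - 1))
    (h : PowerSeries.coeff k (g.1 : PowerSeries (TensorAlgebra R M)) =
      PowerSeries.coeff k (u.1 : PowerSeries (TensorAlgebra R M))) :
    g⁻¹ * u ∈ filtration R M k :=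
  inv_mul_mem_filtration fun j hj => by
    rcases Nat.eq_zero_or_pos j with rfl | hj'
    · rw [coeff_zero_units, coeff_zero_units]
    · rcases Nat.lt_or_ge j k with h2 | h2
      · rw [hg j hj' (by omega), hu j hj' (by omega)]
      · rw [le_antisymm hj h2, h]

/-- A subgroup that contains `relSubgroup` is everything as soon as it contains units with
arbitrary leading terms in the degrees `p^i`, `i ≤ n`. -/
theorem mem_of_leading (p n : ℕ) (hp : 1 < p) (H : Subgroup (SpecialUnits R M))
    (hH : relSubgroup R M p n ≤ H)
    (h : ∀ i ≤ n, ∀ c : ⨂[R]^(p ^ i) M, ∃ g ∈ H, g ∈ filtration R M (p ^ i - 1) ∧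
      PowerSeries.coeff (p ^ i) (g.1 : PowerSeries (TensorAlgebra R M)) =
        TensorPower.toTensorAlgebra c) (u : SpecialUnits R M) : u ∈ H := by
  have h0 : filtration R M 0 ≤ H := by
    refine filtration_le_of_isClosed H
      (isClosed_of_filtration_le H ((filtration_le_relSubgroup p n hp).trans hH)) fun k hk c => ?_
    by_cases hkp : ∀ i ≤ n, k ≠ p ^ i
    · obtain ⟨g, hg, h1⟩ := exists_mem_relSubgroup (R := R) (M := M) p n hk hkp c
      exact ⟨g, hH hg, h1⟩
    · push Not at hkp
      obtain ⟨i, hi, rfl⟩ := hkp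
      exact h i hi c
  exact h0 fun j hj hj0 => absurd hj0 (by omega)

end Filtration

/-! ### Relations and coordinates in the truncated Witt vectors -/

section Witt

variable {R : Type*} [CommRing R] {M : Type*} [AddCommGroup M] [Module R M]

theorem W.mk_mul (p n : ℕ) (u v : SpecialUnits R M) :
    W.mk R p n (u * v) = W.mk R p n u + W.mk R p n v := rfl

theorem W.mk_inv (p n : ℕ) (u : SpecialUnits R M) : W.mk R p n u⁻¹ = -W.mk R p n u := rfl

theorem W.mk_surjective (p n : ℕ) (w : W R M p n) : ∃ u, W.mk R p n u = w :=
  QuotientGroup.mk_surjective (Additive.toMul w)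

theorem W.mk_eq_zero {p n : ℕ} {u : SpecialUnits R M} (h : u ∈ relSubgroup R M p n) :
    W.mk R p n u = 0 :=
  congrArg Additive.ofMul ((QuotientGroup.eq_one_iff u).2 h)

theorem oneSub_conj {A : Type*} [Ring A] {x y B : A} (h1 : B * (1 - y) = 1)
    (h2 : (1 - y) * B = 1) : (1 - x) * B * (1 - y * x) = (1 - x * y) * B * (1 - x) := by
  have e1 : (1 - x) * B * (1 - y * x) = (1 - x) * (B * (1 - y)) * x + (1 - x) * B * (1 - x) := by
    noncomm_ring
  have e2 : (1 - x * y) * B * (1 - x) = x * ((1 - y) * B) * (1 - x) + (1 - x) * B * (1 - x) := by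
    noncomm_ring
  rw [e1, e2, h1, h2]
  noncomm_ring

theorem monomial_mul_monomial {A : Type*} [Semiring A] (r s : ℕ) (a b : A) :
    PowerSeries.monomial r a * PowerSeries.monomial s b = PowerSeries.monomial (r + s) (a * b) := by
  ext k
  rw [PowerSeries.coeff_mul, PowerSeries.coeff_monomial]
  simp only [PowerSeries.coeff_monomial]
  split_ifs with h
  · rw [Finset.sum_eq_single (r, s)]
    · simp
    · rintro ⟨i, j⟩ hx hne
      by_cases hi : i = r
      · have : j ≠ s := fun hj => hne (by rw [hi, hj])
        simp [this]
      · simp [hi]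
    · intro hn
      exact absurd (by rw [Finset.HasAntidiagonal.mem_antidiagonal]; exact h.symm) hn
  · refine Finset.sum_eq_zero ?_
    rintro ⟨i, j⟩ hx
    rw [Finset.HasAntidiagonal.mem_antidiagonal] at hx
    by_cases hi : i = r
    · have : j ≠ s := fun hj => h (by rw [← hx, hi, hj])
      simp [this]
    · simp [hi]

/-- The classes of `1 - ab t^k` and `1 - ba t^k` agree. -/
theorem W.mk_oneSub_mul_comm (p n : ℕ) {r s k : ℕ} (hr : 0 < r) (hs : 0 < s) (hk : 0 < k)
    (hrs : r + s = k) (a : ⨂[R]^r M) (b : ⨂[R]^s M) {c c' : ⨂[R]^k M}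
    (hc : TensorPower.toTensorAlgebra c =
      TensorPower.toTensorAlgebra a * TensorPower.toTensorAlgebra b)
    (hc' : TensorPower.toTensorAlgebra c' =
      TensorPower.toTensorAlgebra b * TensorPower.toTensorAlgebra a) :
    W.mk R p n (oneSub R k hk c) = W.mk R p n (oneSub R k hk c') := by
  have key : oneSub R r hr a * (oneSub R s hs b)⁻¹ * oneSub R k hk c' =
      oneSub R k hk c * (oneSub R s hs b)⁻¹ * oneSub R r hr a := by
    apply Subtype.ext
    apply Units.ext
    have e := oneSub_conj (x := PowerSeries.monomial r (TensorPower.toTensorAlgebra a))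
      (y := PowerSeries.monomial s (TensorPower.toTensorAlgebra b))
      (oneSub R s hs b).1.inv_mul (oneSub R s hs b).1.mul_inv
    rw [monomial_mul_monomial, monomial_mul_monomial, ← hc, ← hc', hrs, add_comm s r, hrs] at e
    exact e
  have h := congrArg (W.mk R p n) key
  simp only [W.mk_mul] at h
  rw [add_comm, add_assoc (W.mk R p n (oneSub R k hk c)), add_comm (W.mk R p n _⁻¹)] at h
  exact (add_right_cancel h).symm

theorem W.mk_oneSub_comp_finRotate (p n : ℕ) {k : ℕ} (hk : 0 < k) (f : Fin k → M) :
    W.mk R p n (oneSub R k hk (PiTensorProduct.tprod R (f ∘ finRotate k))) =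
      W.mk R p n (oneSub R k hk (PiTensorProduct.tprod R f)) := by
  obtain ⟨r, rfl⟩ : ∃ r, k = r + 1 := ⟨k - 1, by omega⟩
  rcases Nat.eq_zero_or_pos r with rfl | hr
  · simp
  · have hf : f = Fin.append (fun _ : Fin 1 => f 0) (Fin.tail f) ∘ Fin.cast (add_comm r 1) := by
      rw [Fin.append_left_eq_cons]
      ext l
      conv_lhs => rw [← Fin.cons_self_tail f]
      simp
    have h := append_comp_finRotate_pow (Fin.tail f) fun _ : Fin 1 => f 0
    rw [← hf, pow_one] at h
    refine W.mk_oneSub_mul_comm p n hr one_pos hk rfl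
      (PiTensorProduct.tprod R (Fin.tail f)) (PiTensorProduct.tprod R fun _ : Fin 1 => f 0) ?_ ?_
    · rw [h, toTensorAlgebra_tprod_mul]
    · rw [toTensorAlgebra_tprod_mul, ← toTensorAlgebra_cast (add_comm 1 r),
        TensorPower.cast_tprod, ← hf]

theorem W.mk_oneSub_comp_zpow_finRotate (p n : ℕ) {k : ℕ} (hk : 0 < k) (f : Fin k → M)
    {σ : Equiv.Perm (Fin k)} (hσ : σ ∈ Subgroup.zpowers (finRotate k)) :
    W.mk R p n (oneSub R k hk (PiTensorProduct.tprod R (f ∘ σ))) =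
      W.mk R p n (oneSub R k hk (PiTensorProduct.tprod R f)) := by
  obtain ⟨z, rfl⟩ := Subgroup.mem_zpowers_iff.1 hσ
  induction z using Int.induction_on generalizing f with
  | zero => simp
  | succ z ih =>
    rw [add_comm, zpow_add, zpow_one, Equiv.Perm.coe_mul, ← Function.comp_assoc,
      ih _ (zpow_mem (Subgroup.mem_zpowers _) _), W.mk_oneSub_comp_finRotate]
  | pred z ih =>
    rw [sub_eq_add_neg, add_comm, zpow_add, zpow_neg_one, Equiv.Perm.coe_mul,
      ← Function.comp_assoc, ih _ (zpow_mem (Subgroup.mem_zpowers _) _),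
      ← W.mk_oneSub_comp_finRotate, Function.comp_assoc, ← Equiv.Perm.coe_mul, inv_mul_cancel]
    rfl

theorem verUnits_oneSub_tprod {k : ℕ} (hk : 0 < k) (m : ⨂[R]^k M) :
    verUnits R M k hk (oneSub R 1 one_pos (PiTensorProduct.tprod R fun _ => m)) =
      oneSub R k hk m := by
  apply Subtype.ext
  apply Units.ext
  ext j
  rw [coeff_verUnits, coeff_oneSub, coeff_oneSub]
  by_cases h : k ∣ j
  · obtain ⟨q, rfl⟩ := h
    rw [if_pos (dvd_mul_right k q), Nat.mul_div_cancel_left _ hk, map_sub]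
    congr 1
    · by_cases hq : q = 0 <;> simp [hq, hk.ne']
    · by_cases hq : q = 1
      · simp [hq, flatten]
      · simp [hq, hk.ne']
  · have h0 : j ≠ 0 := by rintro rfl; exact h (dvd_zero _)
    have h1 : j ≠ k := by rintro rfl; exact h dvd_rfl
    simp [h, h0, h1]

theorem ver_teich (p : ℕ) [hp : Fact p.Prime] {n i : ℕ} (hi : i ≤ n) (m : ⨂[R]^(p ^ i) M) :
    ver R p hi (teich R p (n - i) m) =
      W.mk R p n (oneSub R (p ^ i) (pow_pos hp.out.pos i) m) := by
  rw [← verUnits_oneSub_tprod]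
  rfl

theorem oneSub_zero {k : ℕ} (hk : 0 < k) : oneSub R k hk (0 : ⨂[R]^k M) = 1 := by
  apply Subtype.ext
  apply Units.ext
  ext j
  rw [coeff_oneSub]
  simp [PowerSeries.coeff_one]

theorem wittCoord_single (p : ℕ) [hp : Fact p.Prime] {n : ℕ} (i : Fin (n + 1))
    (m : ⨂[R]^(p ^ (i : ℕ)) M) :
    wittCoord R p n (Pi.single i m) =
      W.mk R p n (oneSub R (p ^ (i : ℕ)) (pow_pos hp.out.pos _) m) := by
  rw [wittCoord, Finset.sum_eq_single i]
  · rw [Pi.single_eq_same]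
  · intro j _ hj
    rw [Pi.single_eq_of_ne hj, oneSub_zero]
    rfl
  · simp

theorem wittCoord_surjective (p : ℕ) [hp : Fact p.Prime] (n : ℕ) (w : W R M p n) :
    ∃ m, wittCoord R p n m = w := by
  obtain ⟨u, rfl⟩ := W.mk_surjective p n w
  have key : ∀ K, ∃ m : ∀ i : Fin (n + 1), ⨂[R]^(p ^ (i : ℕ)) M,
      (∀ i : Fin (n + 1), K < p ^ (i : ℕ) → m i = 0) ∧ ∃ v ∈ filtration R M K,
        W.mk R p n u = wittCoord R p n m + W.mk R p n v := by
    intro K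
    induction K with
    | zero =>
      refine ⟨0, fun _ _ => rfl, u, fun j hj hj' => absurd hj' (by omega), ?_⟩
      have h0 : wittCoord R p n (0 : ∀ i : Fin (n + 1), ⨂[R]^(p ^ (i : ℕ)) M) = 0 :=
        Finset.sum_eq_zero fun i _ => by rw [Pi.zero_apply, oneSub_zero]; rfl
      rw [h0, zero_add]
    | succ K ih =>
      obtain ⟨m, hm, v, hv, hu⟩ := ih
      obtain ⟨c, hc⟩ := v.2.2 (K + 1)
      by_cases hK : ∀ i ≤ n, K + 1 ≠ p ^ i
      · obtain ⟨g, hg, hgF, hgc⟩ := exists_mem_relSubgroup p n K.succ_pos hK c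
        refine ⟨m, fun i hi => hm i (by omega), g⁻¹ * v,
          inv_mul_mem_filtration_of_coeff_eq hgF hv (hgc.trans hc), ?_⟩
        rw [W.mk_mul, W.mk_inv, W.mk_eq_zero hg, neg_zero, zero_add, hu]
      · push Not at hK
        obtain ⟨i, hi, hKi⟩ := hK
        obtain ⟨i, rfl⟩ : ∃ i' : Fin (n + 1), i = i' := ⟨⟨i, by omega⟩, rfl⟩
        obtain ⟨c, rfl⟩ : ∃ c', c = TensorPower.cast R M hKi.symm c' :=
          ⟨TensorPower.cast R M hKi c, by simp [TensorPower.cast_cast]⟩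
        rw [toTensorAlgebra_cast, hKi] at hc
        have hvF : v ∈ filtration R M (p ^ (i : ℕ) - 1) := by rwa [← hKi]
        refine ⟨m + Pi.single i (-c), fun j hj => ?_,
          (oneSub R (p ^ (i : ℕ)) (pow_pos hp.out.pos _) (-c))⁻¹ * v, ?_, ?_⟩
        · have hji : j ≠ i := by rintro rfl; omega
          rw [Pi.add_apply, Pi.single_eq_of_ne hji, add_zero, hm j (by omega)]
        · rw [hKi]
          refine inv_mul_mem_filtration_of_coeff_eq (oneSub_mem_filtration _ _) hvF ?_
          rw [coeff_oneSub, if_neg (pow_pos hp.out.pos _).ne', if_pos rfl, map_neg, zero_sub,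
            neg_neg, hc]
        · rw [W.mk_mul, W.mk_inv, hu, ← wittCoord_single, ← add_assoc]
          congr 1
          rw [eq_add_neg_iff_add_eq]
          rw [wittCoord, wittCoord, wittCoord, ← Finset.sum_add_distrib]
          refine Finset.sum_congr rfl fun j _ => ?_
          rcases eq_or_ne j i with rfl | hji
          · rw [Pi.add_apply, hm j (by omega), zero_add, oneSub_zero]
            exact zero_add _
          · rw [Pi.add_apply, Pi.single_eq_of_ne hji, add_zero, oneSub_zero]
            exact add_zero _
  obtain ⟨m, _, v, hv, hu⟩ := key (p ^ n)
  refine ⟨m, ?_⟩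
  rw [hu, W.mk_eq_zero (filtration_le_relSubgroup p n hp.out.one_lt hv), add_zero]

end Witt

/-! ### The logarithmic derivative and the ghost components -/

section Log

/-- The derivation `t d/dt` of a power series ring. -/
def euler {A : Type*} [Ring A] : PowerSeries A →+ PowerSeries A where
  toFun f := PowerSeries.mk fun k => k • PowerSeries.coeff k f
  map_zero' := by ext k; simp
  map_add' f g := by ext k; simp

theorem coeff_euler {A : Type*} [Ring A] (f : PowerSeries A) (k : ℕ) :
    PowerSeries.coeff k (euler f) = k • PowerSeries.coeff k f :=
  PowerSeries.coeff_mk k fun k => k • PowerSeries.coeff k f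

theorem euler_mul {A : Type*} [Ring A] (f g : PowerSeries A) :
    euler (f * g) = euler f * g + f * euler g := by
  ext k
  rw [coeff_euler, map_add, PowerSeries.coeff_mul, PowerSeries.coeff_mul, PowerSeries.coeff_mul,
    Finset.smul_sum, ← Finset.sum_add_distrib]
  refine Finset.sum_congr rfl fun x hx => ?_
  rw [Finset.HasAntidiagonal.mem_antidiagonal] at hx
  rw [coeff_euler, coeff_euler, ← hx, add_smul, smul_mul_assoc, mul_smul_comm]

variable {R : Type*} [CommRing R] {M : Type*} [AddCommGroup M] [Module R M]

theorem coeff_mul_mem_deg {f g : PowerSeries (TensorAlgebra R M)}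
    (hf : ∀ k, PowerSeries.coeff k f ∈ deg R M k) (hg : ∀ k, PowerSeries.coeff k g ∈ deg R M k)
    (k : ℕ) : PowerSeries.coeff k (f * g) ∈ deg R M k := by
  rw [PowerSeries.coeff_mul]
  refine Submodule.sum_mem _ fun x hx => ?_
  rw [← Finset.HasAntidiagonal.mem_antidiagonal.1 hx]
  exact mul_mem_deg (hf _) (hg _)

theorem coeff_euler_mem_deg {f : PowerSeries (TensorAlgebra R M)}
    (hf : ∀ k, PowerSeries.coeff k f ∈ deg R M k) (k : ℕ) :
    PowerSeries.coeff k (euler f) ∈ deg R M k := by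
  rw [coeff_euler]
  exact nsmul_mem (hf k) k

theorem cyclicTrace_coeff_mul_comm (N : ℕ) {f g : PowerSeries (TensorAlgebra R M)}
    (hf : ∀ k, PowerSeries.coeff k f ∈ deg R M k)
    (hg : ∀ k, PowerSeries.coeff k g ∈ deg R M k) :
    cyclicTrace N (PowerSeries.coeff N (f * g)) = cyclicTrace N (PowerSeries.coeff N (g * f)) := by
  rw [PowerSeries.coeff_mul, PowerSeries.coeff_mul, map_sum, map_sum,
    ← Finset.Nat.sum_antidiagonal_swap]
  exact Finset.sum_congr rfl fun x _ => cyclicTrace_mul_comm N (hf _) (hg _)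

variable (R M) in
/-- The cyclic trace of the coefficient of `t^N` in the negative logarithmic derivative
`-t f' f⁻¹`. -/
def logTrace (N : ℕ) : SpecialUnits R M →* Multiplicative (⨂[R]^N M) :=
  MonoidHom.mk' (fun u => Multiplicative.ofAdd
    (-cyclicTrace N (PowerSeries.coeff N (euler u.1.1 * (u⁻¹).1.1)))) fun u v => by
    rw [← ofAdd_add, ← neg_add, ← map_add, ← map_add]
    have h1 : (u * v)⁻¹.1.1 = v⁻¹.1.1 * u⁻¹.1.1 := by rw [mul_inv_rev]; rfl
    have h2 : v.1.1 * v⁻¹.1.1 = 1 := v.1.mul_inv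
    have h3 : u⁻¹.1.1 * u.1.1 = 1 := u.1.inv_mul
    have h4 : euler (u * v).1.1 * (u * v)⁻¹.1.1 =
        euler u.1.1 * u⁻¹.1.1 + u.1.1 * (euler v.1.1 * v⁻¹.1.1 * u⁻¹.1.1) := by
      change euler (u.1.1 * v.1.1) * _ = _
      rw [h1, euler_mul, add_mul, mul_assoc, ← mul_assoc v.1.1, h2, one_mul]
      simp only [mul_assoc]
    have h5 := cyclicTrace_coeff_mul_comm N u.2.2
      (coeff_mul_mem_deg (coeff_mul_mem_deg (coeff_euler_mem_deg v.2.2) v⁻¹.2.2) u⁻¹.2.2)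
    rw [mul_assoc _ u⁻¹.1.1, h3, mul_one] at h5
    rw [h4, map_add, map_add, h5, map_add, map_add]

theorem toAdd_logTrace (N : ℕ) (u : SpecialUnits R M) :
    (logTrace R M N u).toAdd =
      -cyclicTrace N (PowerSeries.coeff N (euler u.1.1 * (u⁻¹).1.1)) := rfl

theorem filtration_le_ker_logTrace (N : ℕ) : filtration R M N ≤ (logTrace R M N).ker := by
  intro u hu
  rw [MonoidHom.mem_ker]
  apply Multiplicative.toAdd.injective
  rw [toAdd_logTrace, PowerSeries.coeff_mul, Finset.sum_eq_zero, map_zero, neg_zero, toAdd_one]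
  rintro ⟨a, b⟩ hx
  rw [Finset.HasAntidiagonal.mem_antidiagonal] at hx
  simp only at hx ⊢
  rw [coeff_euler]
  rcases Nat.eq_zero_or_pos a with rfl | ha
  · rw [zero_smul, zero_mul]
  · rw [hu a ha (by omega), smul_zero, zero_mul]

theorem coeff_inv_one_sub_monomial {A : Type*} [Ring A] {k : ℕ} (hk : 0 < k) {a : A}
    {h : PowerSeries A} (hh : (1 - PowerSeries.monomial k a) * h = 1) (N : ℕ) :
    PowerSeries.coeff N h = if k ∣ N then a ^ (N / k) else 0 := by
  induction N using Nat.strong_induction_on with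
  | _ N ih =>
    have h1 : h = 1 + PowerSeries.C a * (PowerSeries.X ^ k * h) := by
      rw [← mul_assoc, ← PowerSeries.monomial_eq_C_mul_X_pow, ← hh, sub_mul, one_mul,
        sub_add_cancel]
    rw [h1, map_add, PowerSeries.coeff_C_mul, PowerSeries.coeff_X_pow_mul', PowerSeries.coeff_one]
    rcases Nat.eq_zero_or_pos N with rfl | hN
    · simp [hk.ne']
    · rw [if_neg hN.ne', zero_add]
      by_cases hkN : k ≤ N
      · obtain ⟨d, rfl⟩ := Nat.exists_eq_add_of_le' hkN
        rw [if_pos hkN, Nat.add_sub_cancel, ih d (by omega), Nat.add_div_right _ hk]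
        simp only [Nat.dvd_add_self_right]
        split_ifs
        · rw [pow_succ']
        · rw [mul_zero]
      · rw [if_neg hkN, mul_zero, if_neg]
        exact fun hd => hkN (Nat.le_of_dvd hN hd)

theorem logTrace_oneSub {k N : ℕ} (hk : 0 < k) (hN : 0 < N) (a : ⨂[R]^k M) :
    (logTrace R M N (oneSub R k hk a)).toAdd =
      if k ∣ N then k • cyclicTrace N (TensorPower.toTensorAlgebra a ^ (N / k)) else 0 := by
  have h0 : (1 - PowerSeries.monomial k (TensorPower.toTensorAlgebra a)) *
      (oneSub R k hk a)⁻¹.1.1 = 1 := (oneSub R k hk a).1.mul_inv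
  have h1 : euler (oneSub R k hk a).1.1 =
      -(k • PowerSeries.monomial k (TensorPower.toTensorAlgebra a)) := by
    ext j
    rw [coeff_euler, coeff_oneSub, map_neg, map_nsmul, PowerSeries.coeff_monomial]
    rcases Nat.eq_zero_or_pos j with rfl | hj
    · simp [hk.ne]
    · rw [if_neg hj.ne', zero_sub, smul_neg]
      split_ifs with h
      · rw [h]
      · simp
  have h2 : PowerSeries.monomial k (TensorPower.toTensorAlgebra a) * (oneSub R k hk a)⁻¹.1.1 =
      (oneSub R k hk a)⁻¹.1.1 - 1 := by
    rw [← h0, sub_mul, one_mul, sub_sub_cancel]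
  rw [toAdd_logTrace, h1, neg_mul, map_neg, map_neg, neg_neg, smul_mul_assoc, map_nsmul,
    map_nsmul, h2, map_sub, PowerSeries.coeff_one, if_neg hN.ne', sub_zero,
    coeff_inv_one_sub_monomial hk h0]
  split_ifs
  · rfl
  · rw [map_zero]
    exact nsmul_zero k

theorem relSubgroup_le_ker_logTrace {p n j : ℕ} (hp : p.Prime) (hj : j ≤ n) :
    relSubgroup R M p n ≤ (logTrace R M (p ^ j)).ker := by
  refine sInf_le ⟨inferInstance,
    isClosed_of_filtration_le _ (filtration_le_ker_logTrace (p ^ j)), ?_⟩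
  rintro u (⟨f, g, rfl⟩ | ⟨k, hk, m, hkp, rfl⟩)
  · rw [SetLike.mem_coe, MonoidHom.mem_ker]
    simp
  · rw [SetLike.mem_coe, MonoidHom.mem_ker]
    apply Multiplicative.toAdd.injective
    rw [logTrace_oneSub hk (pow_pos hp.pos j), if_neg, toAdd_one]
    intro hd
    obtain ⟨i, hi, rfl⟩ := (Nat.dvd_prime_pow hp).1 hd
    exact hkp i (hi.trans hj) rfl

variable (R M) in
/-- The additive map that sends the class of `∏ (1 - m_i t^{p^i})` to `p^j` times its `j`-th ghost
component. -/
def scaledGhost (p : ℕ) [hp : Fact p.Prime] {n j : ℕ} (hj : j ≤ n) :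
    W R M p n →+ ⨂[R]^(p ^ j) M :=
  MonoidHom.toAdditiveLeft (QuotientGroup.lift _ (logTrace R M (p ^ j))
    (relSubgroup_le_ker_logTrace hp.out hj))

theorem scaledGhost_mk (p : ℕ) [hp : Fact p.Prime] {n j : ℕ} (hj : j ≤ n)
    (u : SpecialUnits R M) :
    scaledGhost R M p hj (W.mk R p n u) = (logTrace R M (p ^ j) u).toAdd := rfl

theorem scaledGhost_oneSub (p : ℕ) [hp : Fact p.Prime] {n j : ℕ} (hj : j ≤ n) {i : ℕ}
    (a : ⨂[R]^(p ^ i) M) :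
    scaledGhost R M p hj (W.mk R p n (oneSub R (p ^ i) (pow_pos hp.out.pos i) a)) =
      if h : i ≤ j then (p : R) ^ j • ∑ s ∈ Finset.range (p ^ i), (rot (p ^ j) ^ s) (tensPow p h a)
      else 0 := by
  rw [scaledGhost_mk, logTrace_oneSub _ (pow_pos hp.out.pos j)]
  by_cases h : i ≤ j
  · rw [if_pos (pow_dvd_pow p h), dif_pos h, Nat.pow_div h hp.out.pos,
      cyclicTrace_toTensorAlgebra_pow hp.out.pos h, smul_smul, ← pow_add,
      Nat.add_sub_cancel' h, ← Nat.cast_pow]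
    exact (Nat.cast_smul_eq_nsmul R _ _).symm
  · rw [if_neg (fun hd => h ((Nat.pow_dvd_pow_iff_le_right hp.out.one_lt).1 hd)), dif_neg h]

theorem scaledGhost_wittCoord (p : ℕ) [hp : Fact p.Prime] {n j : ℕ} (hj : j ≤ n)
    (m : ∀ i : Fin (n + 1), ⨂[R]^(p ^ (i : ℕ)) M) :
    scaledGhost R M p hj (wittCoord R p n m) = (p : R) ^ j • ghost p n j m := by
  rw [wittCoord, map_sum, ghost, Finset.smul_sum]
  refine Finset.sum_congr rfl fun i _ => ?_
  rw [scaledGhost_oneSub]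
  split_ifs
  · rfl
  · rw [smul_zero]

end Log

/-! ### The product of words on ghost components -/

section Product

variable {R : Type*} [CommRing R] {M : Type*} [AddCommGroup M] [Module R M]
  {N : Type*} [AddCommGroup N] [Module R N] {P : Type*} [AddCommGroup P] [Module R P]

variable (R M N P) in
/-- Bilinear maps `M × N → P`. -/
abbrev Bilinear : Type _ := M →ₗ[R] N →ₗ[R] P

/-- The map `M^{⊗k} × N^{⊗k} → P^{⊗k}` induced by a bilinear map `M × N → P`. -/
def tensorMap₂ (μ : Bilinear R M N P) (k : ℕ) : (⨂[R]^k M) →ₗ[R] (⨂[R]^k N) →ₗ[R] ⨂[R]^k P :=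
  PiTensorProduct.map₂ fun _ => μ

theorem tensorMap₂_seqTensor (μ : Bilinear R M N P) (k : ℕ) (F : ℤ → M) (G : ℤ → N) :
    tensorMap₂ μ k (seqTensor R k F) (seqTensor R k G) = seqTensor R k fun z => μ (F z) (G z) :=
  PiTensorProduct.map₂_tprod_tprod _ _ _

theorem tensorMap₂_smul_smul (μ : Bilinear R M N P) (k : ℕ) (q : R) (a : ⨂[R]^k M) (b : ⨂[R]^k N) :
    tensorMap₂ μ k (q • a) (q • b) = q • q • tensorMap₂ μ k a b := by
  rw [map_smul, map_smul, LinearMap.smul_apply]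

theorem tensorMap₂_sum_sum (μ : Bilinear R M N P) (k : ℕ) {α β : Type*} (s : Finset α) (t : Finset β) (f : α → ⨂[R]^k M)
    (g : β → ⨂[R]^k N) :
    tensorMap₂ μ k (∑ i ∈ s, f i) (∑ j ∈ t, g j) = ∑ i ∈ s, ∑ j ∈ t, tensorMap₂ μ k (f i) (g j) := by
  rw [LinearMap.map_sum₂]
  exact Finset.sum_congr rfl fun i _ => map_sum _ _ _

theorem sum_range_seqTensor_sub {k : ℕ} {q : ℕ} (hq : q ∣ k) {F : ℤ → M}
    (hF : Function.Periodic F (q : ℤ)) (t : ℕ) :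
    ∑ s ∈ Finset.range q, seqTensor R k (fun z => F (z - (s + t : ℕ))) =
      ∑ s ∈ Finset.range q, seqTensor R k (fun z => F (z - s)) := by
  have hFk := periodic_mul_nat hF hq
  have h1 : (rot k ^ q) (seqTensor R k F) = seqTensor R k F := by
    rw [rot_pow_seqTensor hFk]
    congr 1
    ext z
    exact hF.sub_eq z
  have h2 := sum_range_rot_pow_add q h1 t
  simpa only [rot_pow_seqTensor hFk] using h2

theorem scaledGhost_oneSub_seqTensor (p : ℕ) [hp : Fact p.Prime] {n m : ℕ} (hm : m ≤ n) {i : ℕ}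
    (him : i ≤ m) {F : ℤ → M} (hF : Function.Periodic F ((p ^ i : ℕ) : ℤ)) :
    scaledGhost R M p hm
        (W.mk R p n (oneSub R (p ^ i) (pow_pos hp.out.pos i) (seqTensor R (p ^ i) F))) =
      (p : R) ^ m • ∑ s ∈ Finset.range (p ^ i), seqTensor R (p ^ m) fun z => F (z - s) := by
  rw [scaledGhost_oneSub, dif_pos him, tensPow_seqTensor p him hF]
  simp only [rot_pow_seqTensor (periodic_mul_nat hF (pow_dvd_pow p him))]

theorem tensorMap₂_scaledGhost_of_le (μ : Bilinear R M N P) (p : ℕ) [hp : Fact p.Prime] {n m : ℕ} (hm : m ≤ n) {i j : ℕ}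
    (hij : i ≤ j) {F : ℤ → M} (hF : Function.Periodic F ((p ^ i : ℕ) : ℤ)) {G : ℤ → N}
    (hG : Function.Periodic G ((p ^ j : ℕ) : ℤ)) :
    tensorMap₂ μ (p ^ m)
        (scaledGhost R M p hm
          (W.mk R p n (oneSub R (p ^ i) (pow_pos hp.out.pos i) (seqTensor R (p ^ i) F))))
        (scaledGhost R N p hm
          (W.mk R p n (oneSub R (p ^ j) (pow_pos hp.out.pos j) (seqTensor R (p ^ j) G)))) =
      (p : R) ^ m • scaledGhost R (P) p hm (∑ s ∈ Finset.range (p ^ i),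
        W.mk R p n (oneSub R (p ^ j) (pow_pos hp.out.pos j)
          (tensorMap₂ μ (p ^ j) (tensPow p hij ((rot (p ^ i) ^ s) (seqTensor R (p ^ i) F)))
            (seqTensor R (p ^ j) G)))) := by
  by_cases hjm : j ≤ m
  · have hs (s : ℕ) : Function.Periodic (fun z => F (z - s)) ((p ^ i : ℕ) : ℤ) := hF.sub_const _
    have hFG (s : ℕ) : Function.Periodic (fun z => μ (F (z - s)) (G z)) ((p ^ j : ℕ) : ℤ) :=
      fun z => congrArg₂ (μ · ·) (periodic_mul_nat (hs s) (pow_dvd_pow p hij) z) (hG z)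
    rw [scaledGhost_oneSub_seqTensor p hm (hij.trans hjm) hF,
      scaledGhost_oneSub_seqTensor p hm hjm hG, tensorMap₂_smul_smul, tensorMap₂_sum_sum, map_sum]
    congr 1
    simp only [rot_pow_seqTensor hF, tensPow_seqTensor p hij (hs _), tensorMap₂_seqTensor,
      scaledGhost_oneSub_seqTensor p hm hjm (hFG _)]
    rw [← Finset.smul_sum]
    congr 1
    rw [Finset.sum_comm, Finset.sum_comm (s := Finset.range (p ^ i))]
    refine Finset.sum_congr rfl fun t _ => ?_
    have h := congrArg (fun a => tensorMap₂ μ (p ^ m) a (seqTensor R (p ^ m) fun z => G (z - t)))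
      (sum_range_seqTensor_sub (R := R) (pow_dvd_pow p (hij.trans hjm)) hF t)
    simp only [LinearMap.map_sum₂, tensorMap₂_seqTensor] at h
    rw [← h]
    refine Finset.sum_congr rfl fun s _ => ?_
    congr 1
    ext z
    congr 2
    push_cast
    rw [sub_sub, add_comm (s : ℤ)]
  · rw [map_sum]
    simp only [scaledGhost_oneSub, dif_neg hjm]
    rw [map_zero, Finset.sum_const_zero, smul_zero]

theorem tensorMap₂_scaledGhost_of_ge (μ : Bilinear R M N P) (p : ℕ) [hp : Fact p.Prime] {n m : ℕ} (hm : m ≤ n) {i j : ℕ}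
    (hji : j ≤ i) {F : ℤ → M} (hF : Function.Periodic F ((p ^ i : ℕ) : ℤ)) {G : ℤ → N}
    (hG : Function.Periodic G ((p ^ j : ℕ) : ℤ)) :
    tensorMap₂ μ (p ^ m)
        (scaledGhost R M p hm
          (W.mk R p n (oneSub R (p ^ i) (pow_pos hp.out.pos i) (seqTensor R (p ^ i) F))))
        (scaledGhost R N p hm
          (W.mk R p n (oneSub R (p ^ j) (pow_pos hp.out.pos j) (seqTensor R (p ^ j) G)))) =
      (p : R) ^ m • scaledGhost R (P) p hm (∑ s ∈ Finset.range (p ^ j),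
        W.mk R p n (oneSub R (p ^ i) (pow_pos hp.out.pos i)
          (tensorMap₂ μ (p ^ i) (seqTensor R (p ^ i) F)
            (tensPow p hji ((rot (p ^ j) ^ s) (seqTensor R (p ^ j) G)))))) := by
  by_cases him : i ≤ m
  · have hs (s : ℕ) : Function.Periodic (fun z => G (z - s)) ((p ^ j : ℕ) : ℤ) := hG.sub_const _
    have hFG (s : ℕ) : Function.Periodic (fun z => μ (F z) (G (z - s))) ((p ^ i : ℕ) : ℤ) :=
      fun z => congrArg₂ (μ · ·) (hF z) (periodic_mul_nat (hs s) (pow_dvd_pow p hji) z)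
    rw [scaledGhost_oneSub_seqTensor p hm him hF,
      scaledGhost_oneSub_seqTensor p hm (hji.trans him) hG, tensorMap₂_smul_smul, tensorMap₂_sum_sum,
      map_sum]
    congr 1
    simp only [rot_pow_seqTensor hG, tensPow_seqTensor p hji (hs _), tensorMap₂_seqTensor,
      scaledGhost_oneSub_seqTensor p hm him (hFG _)]
    rw [← Finset.smul_sum]
    congr 1
    rw [Finset.sum_comm (s := Finset.range (p ^ j))]
    refine Finset.sum_congr rfl fun t _ => ?_
    have h := congrArg (fun a => tensorMap₂ μ (p ^ m) (seqTensor R (p ^ m) fun z => F (z - t)) a)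
      (sum_range_seqTensor_sub (R := R) (pow_dvd_pow p (hji.trans him)) hG t)
    simp only [map_sum, tensorMap₂_seqTensor] at h
    rw [← h]
    refine Finset.sum_congr rfl fun s _ => ?_
    congr 1
    ext z
    congr 2
    push_cast
    ring
  · rw [map_sum]
    simp only [scaledGhost_oneSub, dif_neg him]
    rw [map_zero, LinearMap.zero_apply, Finset.sum_const_zero, smul_zero]

/-- The ghost components of `u` are the products of those of `v` and `w`. -/
def IsGhostProduct (μ : Bilinear R M N P) (p : ℕ) [Fact p.Prime] {n : ℕ} (v : W R M p n) (w : W R N p n)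
    (u : W R (P) p n) : Prop :=
  ∀ j (hj : j ≤ n), tensorMap₂ μ (p ^ j) (scaledGhost R M p hj v) (scaledGhost R N p hj w) =
    (p : R) ^ j • scaledGhost R (P) p hj u

theorem isGhostProduct_zero_left (μ : Bilinear R M N P) (p : ℕ) [Fact p.Prime] {n : ℕ} (w : W R N p n) :
    IsGhostProduct μ p (0 : W R M p n) w 0 := fun j hj => by
  rw [map_zero, map_zero, map_zero, LinearMap.zero_apply, smul_zero]

theorem isGhostProduct_zero_right (μ : Bilinear R M N P) (p : ℕ) [Fact p.Prime] {n : ℕ} (v : W R M p n) :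
    IsGhostProduct μ p v (0 : W R N p n) 0 := fun j hj => by
  rw [map_zero, map_zero, map_zero, smul_zero]

variable {μ : Bilinear R M N P} {p : ℕ} [Fact p.Prime] {n : ℕ}

theorem IsGhostProduct.add_left {v v' : W R M p n} {w : W R N p n} {u u' : W R (P) p n}
    (h : IsGhostProduct μ p v w u) (h' : IsGhostProduct μ p v' w u') :
    IsGhostProduct μ p (v + v') w (u + u') := fun j hj => by
  rw [map_add, map_add, map_add, LinearMap.add_apply, h j hj, h' j hj, smul_add]

theorem IsGhostProduct.add_right {v : W R M p n} {w w' : W R N p n} {u u' : W R (P) p n}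
    (h : IsGhostProduct μ p v w u) (h' : IsGhostProduct μ p v w' u') :
    IsGhostProduct μ p v (w + w') (u + u') := fun j hj => by
  rw [map_add, map_add, map_add, h j hj, h' j hj, smul_add]

theorem IsGhostProduct.neg_left {v : W R M p n} {w : W R N p n} {u : W R (P) p n}
    (h : IsGhostProduct μ p v w u) : IsGhostProduct μ p (-v) w (-u) := fun j hj => by
  rw [map_neg, map_neg, map_neg, LinearMap.neg_apply, h j hj, smul_neg]

theorem IsGhostProduct.neg_right {v : W R M p n} {w : W R N p n} {u : W R (P) p n}
    (h : IsGhostProduct μ p v w u) : IsGhostProduct μ p v (-w) (-u) := fun j hj => by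
  rw [map_neg, map_neg, map_neg, h j hj, smul_neg]

theorem isGhostProduct_wittCoord {a : ∀ i : Fin (n + 1), ⨂[R]^(p ^ (i : ℕ)) M}
    {b : ∀ i : Fin (n + 1), ⨂[R]^(p ^ (i : ℕ)) N}
    {c : ∀ i : Fin (n + 1), ⨂[R]^(p ^ (i : ℕ)) (P)} :
    IsGhostProduct μ p (wittCoord R p n a) (wittCoord R p n b) (wittCoord R p n c) ↔
      ∀ j ≤ n, (p : R) ^ j • (p : R) ^ j • tensorMap₂ μ (p ^ j) (ghost p n j a) (ghost p n j b) =
        (p : R) ^ j • (p : R) ^ j • ghost p n j c := by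
  refine forall_congr' fun j => forall_congr' fun hj => ?_
  rw [scaledGhost_wittCoord, scaledGhost_wittCoord, scaledGhost_wittCoord, tensorMap₂_smul_smul]

theorem isGhostProduct_of_ghost {star : W R M p n →+ W R N p n →+ W R P p n}
    (h : ∀ a b c, star (wittCoord R p n a) (wittCoord R p n b) = wittCoord R p n c →
      ∀ j ≤ n, ghost p n j c = tensorMap₂ μ (p ^ j) (ghost p n j a) (ghost p n j b))
    (v : W R M p n) (w : W R N p n) : IsGhostProduct μ p v w (star v w) := by
  obtain ⟨a, rfl⟩ := wittCoord_surjective p n v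
  obtain ⟨b, rfl⟩ := wittCoord_surjective p n w
  obtain ⟨c, hc⟩ := wittCoord_surjective p n (star (wittCoord R p n a) (wittCoord R p n b))
  rw [← hc, isGhostProduct_wittCoord]
  intro j hj
  rw [h a b c hc.symm j hj]

theorem isGhostProduct_seqTensor_of_le {i j : ℕ} (hij : i ≤ j) (hj : j ≤ n) {F : ℤ → M}
    (hF : Function.Periodic F ((p ^ i : ℕ) : ℤ)) {G : ℤ → N}
    (hG : Function.Periodic G ((p ^ j : ℕ) : ℤ)) :
    IsGhostProduct μ p (ver R p (hij.trans hj) (teich R p (n - i) (seqTensor R (p ^ i) F)))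
      (ver R p hj (teich R p (n - j) (seqTensor R (p ^ j) G)))
      (∑ s ∈ Finset.range (p ^ i), ver R p hj (teich R p (n - j)
        (tensorMap₂ μ (p ^ j) (tensPow p hij ((rot (p ^ i) ^ s) (seqTensor R (p ^ i) F)))
          (seqTensor R (p ^ j) G)))) := fun m hm => by
  simp only [ver_teich]
  exact tensorMap₂_scaledGhost_of_le μ p hm hij hF hG

theorem isGhostProduct_seqTensor_of_ge {i j : ℕ} (hji : j ≤ i) (hi : i ≤ n) {F : ℤ → M}
    (hF : Function.Periodic F ((p ^ i : ℕ) : ℤ)) {G : ℤ → N}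
    (hG : Function.Periodic G ((p ^ j : ℕ) : ℤ)) :
    IsGhostProduct μ p (ver R p hi (teich R p (n - i) (seqTensor R (p ^ i) F)))
      (ver R p (hji.trans hi) (teich R p (n - j) (seqTensor R (p ^ j) G)))
      (∑ s ∈ Finset.range (p ^ j), ver R p hi (teich R p (n - i)
        (tensorMap₂ μ (p ^ i) (seqTensor R (p ^ i) F)
          (tensPow p hji ((rot (p ^ j) ^ s) (seqTensor R (p ^ j) G)))))) := fun m hm => by
  simp only [ver_teich]
  exact tensorMap₂_scaledGhost_of_ge μ p hm hji hF hG

end Product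

/-! ### Words in a basis -/

section Words

variable {R : Type*} [CommRing R] {M : Type*} [AddCommGroup M] [Module R M] {ι : Type*}

/-- The basis of `M^{⊗k}` given by the words in a basis of `M`. -/
def wordBasis (b : Module.Basis ι R M) (k : ℕ) : Module.Basis (Fin k → ι) R (⨂[R]^k M) :=
  Basis.piTensorProduct fun _ => b

theorem wordBasis_apply (b : Module.Basis ι R M) (k : ℕ) (x : Fin k → ι) :
    wordBasis b k x = PiTensorProduct.tprod R (b ∘ x) :=
  Basis.piTensorProduct_apply _ _


theorem smul_tensor_cancel [IsDomain R] (b : Module.Basis ι R M) {k : ℕ} {q : R} (hq : q ≠ 0)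
    {a a' : ⨂[R]^k M} (h : q • a = q • a') : a = a' := by
  apply (wordBasis b k).repr.injective
  ext x
  have h1 := congrArg (fun c => (wordBasis b k).repr c x) h
  simpa [hq] using h1

/-- The coefficient of a word. -/
def wordCoeff (b : Module.Basis ι R M) {k : ℕ} (x : Fin k → ι) : (⨂[R]^k M) →ₗ[R] R :=
  (wordBasis b k).coord x

open scoped Classical in
theorem wordCoeff_tprod (b : Module.Basis ι R M) {k : ℕ} (x y : Fin k → ι) :
    wordCoeff b x (PiTensorProduct.tprod R (b ∘ y)) = if y = x then 1 else 0 := by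
  rw [wordCoeff, ← wordBasis_apply, Module.Basis.coord_apply, Module.Basis.repr_self,
    Finsupp.single_apply]

open scoped Classical in
theorem wordCoeff_rot_pow (b : Module.Basis ι R M) {k : ℕ} (x y : Fin k → ι) (s : ℕ) :
    wordCoeff b x ((rot k ^ s) (PiTensorProduct.tprod R (b ∘ y))) =
      if y = x ∘ ⇑(finRotate k ^ s) then 1 else 0 := by
  have h : b ∘ y = (b ∘ y ∘ ⇑(finRotate k ^ s)⁻¹) ∘ ⇑(finRotate k ^ s) := by
    ext l
    simp
  rw [h, rot_pow_tprod, wordCoeff_tprod]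
  congr 1
  rw [eq_iff_iff]
  constructor
  · rintro rfl
    ext l
    simp
  · rintro rfl
    ext l
    simp

end Words

/-! ### Free modules over the integers -/

section Free

variable {M : Type*} [AddCommGroup M] [Module ℤ M] {ι : Type*}

variable (p : ℕ) [hp : Fact p.Prime] (n : ℕ)

/-- The class of `1 - x₁ ⊗ ⋯ ⊗ x_{p^i} t^{p^i}`, for a word `x` in a basis of `M`. -/
def wordClass (b : Module.Basis ι ℤ M) (i : ℕ) (x : Fin (p ^ i) → ι) : W ℤ M p n :=
  W.mk ℤ p n (oneSub ℤ (p ^ i) (pow_pos hp.out.pos i) (PiTensorProduct.tprod ℤ (b ∘ x)))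

theorem wordClass_eq_of_rel (b : Module.Basis ι ℤ M) (i : ℕ) {x y : Fin (p ^ i) → ι}
    (h : cyclicSetoid ι (p ^ i) x y) : wordClass p n b i x = wordClass p n b i y := by
  obtain ⟨σ, hσ, rfl⟩ := h
  exact (W.mk_oneSub_comp_zpow_finRotate p n _ (b ∘ x) hσ).symm

/-- The class of a word, as a function of its cyclic orbit. -/
def orbitClass (b : Module.Basis ι ℤ M)
    (s : Σ i : Fin (n + 1), Quotient (cyclicSetoid ι (p ^ (i : ℕ)))) : W ℤ M p n :=
  Quotient.lift (wordClass p n b s.1) (fun _ _ h => wordClass_eq_of_rel p n b s.1 h) s.2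

theorem mem_closure_range_orbitClass (b : Module.Basis ι ℤ M) (w : W ℤ M p n) :
    w ∈ AddSubgroup.closure (Set.range (orbitClass p n b)) := by
  obtain ⟨u, rfl⟩ := W.mk_surjective p n w
  let S := AddSubgroup.closure (Set.range (orbitClass p n b))
  let H : Subgroup (SpecialUnits ℤ M) :=
    { carrier := {u | W.mk ℤ p n u ∈ S}
      one_mem' := S.zero_mem
      mul_mem' := fun hu hv => S.add_mem hu hv
      inv_mem' := fun hu => S.neg_mem hu }
  refine mem_of_leading p n hp.out.one_lt H (fun u hu => ?_) (fun i hi c => ?_) u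
  · change W.mk ℤ p n u ∈ S
    rw [W.mk_eq_zero hu]
    exact S.zero_mem
  · have hpos : 0 < p ^ i := pow_pos hp.out.pos i
    let T : AddSubgroup (⨂[ℤ]^(p ^ i) M) :=
      { carrier := {c | ∃ g ∈ H, g ∈ filtration ℤ M (p ^ i - 1) ∧
          PowerSeries.coeff (p ^ i) (g.1 : PowerSeries (TensorAlgebra ℤ M)) =
            TensorPower.toTensorAlgebra c}
        zero_mem' := ⟨1, one_mem _, one_mem _, by
          rw [map_zero]
          exact (PowerSeries.coeff_one _).trans (if_neg hpos.ne')⟩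
        add_mem' := by
          rintro c d ⟨g, hg, hgF, hgc⟩ ⟨h, hh, hhF, hhd⟩
          refine ⟨g * h, mul_mem hg hh, mul_mem hgF hhF, ?_⟩
          rw [coeff_mul_of_lt (fun j hj hjk => hgF j hj (by omega)) hpos, hgc, hhd, map_add]
        neg_mem' := by
          rintro c ⟨g, hg, hgF, hgc⟩
          refine ⟨g⁻¹, inv_mem hg, inv_mem hgF, ?_⟩
          have h1 := coeff_mul_of_lt (v := g⁻¹) (fun j hj hjk => hgF j hj (by omega)) hpos
          rw [mul_inv_cancel] at h1
          rw [map_neg, ← hgc, eq_neg_iff_add_eq_zero, add_comm, ← h1]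
          exact (PowerSeries.coeff_one _).trans (if_neg hpos.ne') }
    have hword (x : Fin (p ^ i) → ι) : wordBasis b (p ^ i) x ∈ T := by
      have hx : wordClass p n b i x ∈ Set.range (orbitClass p n b) :=
        ⟨⟨⟨i, Nat.lt_succ_iff.2 hi⟩, Quotient.mk _ x⟩, rfl⟩
      rw [wordBasis_apply, ← neg_mem_iff]
      refine ⟨oneSub ℤ (p ^ i) hpos (PiTensorProduct.tprod ℤ (b ∘ x)),
        AddSubgroup.subset_closure hx,
        oneSub_mem_filtration _ _, ?_⟩
      rw [coeff_oneSub, if_neg hpos.ne', if_pos rfl, map_neg, zero_sub]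
    change c ∈ T
    rw [← (wordBasis b (p ^ i)).linearCombination_repr c, Finsupp.linearCombination_apply]
    refine T.sum_mem fun x _ => ?_
    exact T.zsmul_mem (hword x) _

theorem scaledGhost_orbitClass_of_lt (b : Module.Basis ι ℤ M) {j : ℕ} (hj : j ≤ n)
    (s : Σ i : Fin (n + 1), Quotient (cyclicSetoid ι (p ^ (i : ℕ)))) (h : j < s.1) :
    scaledGhost ℤ M p hj (orbitClass p n b s) = 0 := by
  obtain ⟨i, q⟩ := s
  induction q using Quotient.inductionOn with | h x
  exact (scaledGhost_oneSub p hj _).trans (dif_neg (not_le.2 h))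

open scoped Classical in
theorem wordCoeff_scaledGhost (b : Module.Basis ι ℤ M) {i : ℕ} (hi : i ≤ n)
    (x y : Fin (p ^ i) → ι) :
    wordCoeff b x (scaledGhost ℤ M p hi (wordClass p n b i y)) =
      (p : ℤ) ^ i * ∑ s ∈ Finset.range (p ^ i), if y = x ∘ ⇑(finRotate (p ^ i) ^ s) then 1 else 0 := by
  have h1 (a : ⨂[ℤ]^(p ^ i) M) : tensPow p le_rfl a = a := by
    apply toTensorAlgebra_injective
    rw [toTensorAlgebra_tensPow, Nat.sub_self, pow_zero, pow_one]
  rw [wordClass, scaledGhost_oneSub, dif_pos le_rfl, map_smul, map_sum, h1, smul_eq_mul]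
  simp only [wordCoeff_rot_pow]

theorem eq_zero_of_scaledGhost_eq_zero (b : Module.Basis ι ℤ M)
    (c : (Σ i : Fin (n + 1), Quotient (cyclicSetoid ι (p ^ (i : ℕ)))) →₀ ℤ)
    (h : ∀ j (hj : j ≤ n), scaledGhost ℤ M p hj
      (Finsupp.linearCombination ℤ (orbitClass p n b) c) = 0) : c = 0 := by
  classical
  have key : ∀ (j : ℕ) (s : Σ i : Fin (n + 1), Quotient (cyclicSetoid ι (p ^ (i : ℕ)))),
      (s.1 : ℕ) = j → c s = 0 := by
    intro j
    induction j using Nat.strong_induction_on with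
    | _ j ih =>
      rintro ⟨i, q⟩ rfl
      induction q using Quotient.inductionOn with | h x
      have hi : (i : ℕ) ≤ n := Nat.lt_succ_iff.1 i.2
      have h1 := congrArg (wordCoeff b x) (h i hi)
      rw [Finsupp.linearCombination_apply, Finsupp.sum, map_sum, map_sum, map_zero,
        Finset.sum_eq_single ⟨i, Quotient.mk _ x⟩] at h1
      · rw [map_zsmul, map_zsmul] at h1
        change c _ • wordCoeff b x (scaledGhost ℤ M p hi (wordClass p n b i x)) = 0 at h1
        rw [wordCoeff_scaledGhost] at h1
        refine (smul_eq_zero.1 h1).resolve_right (ne_of_gt ?_)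
        refine mul_pos (pow_pos (Nat.cast_pos.2 hp.out.pos) _)
          (Finset.sum_pos' (fun s _ => by split_ifs <;> simp)
            ⟨0, Finset.mem_range.2 (pow_pos hp.out.pos _), by simp⟩)
      · rintro ⟨i', q'⟩ _ hne
        rw [map_zsmul, map_zsmul]
        rcases lt_trichotomy (i' : ℕ) i with hlt | heq | hgt
        · rw [ih i' hlt ⟨i', q'⟩ rfl, zero_smul]
        · obtain rfl : i' = i := Fin.ext heq
          induction q' using Quotient.inductionOn with | h y
          change _ • wordCoeff b x (scaledGhost ℤ M p hi (wordClass p n b i' y)) = 0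
          rw [wordCoeff_scaledGhost, Finset.sum_eq_zero, mul_zero, smul_zero]
          intro s _
          refine if_neg fun hyx => hne ?_
          rw [hyx]
          congr 1
          exact (Quotient.sound (show cyclicSetoid ι _ x _ from
            ⟨_, pow_mem (Subgroup.mem_zpowers _) s, rfl⟩)).symm
        · rw [scaledGhost_orbitClass_of_lt p n b hi _ hgt, map_zero, smul_zero]
      · intro hn
        rw [Finsupp.notMem_support_iff.1 hn, zero_smul, map_zero, map_zero]
  ext s
  exact key _ s rfl

/-- The classes of the words, one for each cyclic orbit, form a basis of the truncated Witt
vectors. -/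
def orbitBasis (b : Module.Basis ι ℤ M) :
    Module.Basis (Σ i : Fin (n + 1), Quotient (cyclicSetoid ι (p ^ (i : ℕ)))) ℤ (W ℤ M p n) :=
  Module.Basis.mk (v := orbitClass p n b)
    (linearIndependent_iff.2 fun c hc => eq_zero_of_scaledGhost_eq_zero p n b c fun j hj => by
      rw [hc, map_zero])
    (fun w _ => (AddSubgroup.closure_le (Submodule.span ℤ
      (Set.range (orbitClass p n b))).toAddSubgroup).2 Submodule.subset_span
        (mem_closure_range_orbitClass p n b w))

theorem orbitBasis_apply (b : Module.Basis ι ℤ M)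
    (s : Σ i : Fin (n + 1), Quotient (cyclicSetoid ι (p ^ (i : ℕ)))) :
    orbitBasis p n b s = orbitClass p n b s :=
  Module.Basis.mk_apply _ _ _

variable {p n}

theorem eq_of_scaledGhost_eq (b : Module.Basis ι ℤ M) {w w' : W ℤ M p n}
    (h : ∀ j (hj : j ≤ n), scaledGhost ℤ M p hj w = scaledGhost ℤ M p hj w') : w = w' := by
  rw [← sub_eq_zero]
  have h1 : Finsupp.linearCombination ℤ (orbitClass p n b) ((orbitBasis p n b).repr (w - w')) =
      w - w' := by
    conv_rhs => rw [← (orbitBasis p n b).linearCombination_repr (w - w')]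
    congr 2
    ext s
    exact (orbitBasis_apply p n b s).symm
  have h2 := eq_zero_of_scaledGhost_eq_zero p n b ((orbitBasis p n b).repr (w - w'))
    fun j hj => by rw [h1, map_sub, h j hj, sub_self]
  rw [← h1, h2, map_zero]

end Free

/-! ### The product of truncated Witt vectors -/

section Pairing

variable {M : Type*} [AddCommGroup M] [Module ℤ M] {ι : Type*}
  {N : Type*} [AddCommGroup N] [Module ℤ N] {κ : Type*} {P : Type*} [AddCommGroup P] [hP : Module ℤ P] {ν : Type*}
  {μ : Bilinear ℤ M N P} {p : ℕ} [hp : Fact p.Prime] {n : ℕ}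

theorem IsGhostProduct.unique (b : Module.Basis ν ℤ P)
    {v : W ℤ M p n} {w : W ℤ N p n} {u u'} (h : IsGhostProduct μ p v w u)
    (h' : IsGhostProduct μ p v w u') : u = u' :=
  eq_of_scaledGhost_eq b fun j hj =>
    smul_tensor_cancel b
      (pow_ne_zero j (Nat.cast_ne_zero.2 hp.out.ne_zero)) ((h j hj).symm.trans (h' j hj))

theorem exists_isGhostProduct_orbitClass (b : Module.Basis ι ℤ M) (b' : Module.Basis κ ℤ N)
    (s : Σ i : Fin (n + 1), Quotient (cyclicSetoid ι (p ^ (i : ℕ))))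
    (t : Σ i : Fin (n + 1), Quotient (cyclicSetoid κ (p ^ (i : ℕ)))) :
    ∃ u, IsGhostProduct μ p (orbitClass p n b s) (orbitClass p n b' t) u := by
  obtain ⟨i, x⟩ := s
  obtain ⟨j, y⟩ := t
  induction x using Quotient.inductionOn with | h x
  induction y using Quotient.inductionOn with | h y
  change ∃ u, IsGhostProduct μ p (wordClass p n b i x) (wordClass p n b' j y) u
  obtain ⟨F, hF, hxF⟩ := exists_eq_seqTensor (R := ℤ) (pow_pos hp.out.pos i) (b ∘ x)
  obtain ⟨G, hG, hyG⟩ := exists_eq_seqTensor (R := ℤ) (pow_pos hp.out.pos j) (b' ∘ y)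
  have hi : (i : ℕ) ≤ n := Nat.lt_succ_iff.1 i.2
  have hj : (j : ℕ) ≤ n := Nat.lt_succ_iff.1 j.2
  rw [wordClass, wordClass, hxF, hyG, ← ver_teich p hi, ← ver_teich p hj]
  rcases le_total (i : ℕ) j with h | h
  · exact ⟨_, isGhostProduct_seqTensor_of_le h hj hF hG⟩
  · exact ⟨_, isGhostProduct_seqTensor_of_ge h hi hF hG⟩

variable (μ p n) in
/-- There is a biadditive product whose values are ghost products. -/
theorem exists_pairing (b : Module.Basis ι ℤ M) (b' : Module.Basis κ ℤ N) :
    ∃ star : W ℤ M p n →+ W ℤ N p n →+ W ℤ P p n, ∀ v w, IsGhostProduct μ p v w (star v w) := by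
  choose f hf using exists_isGhostProduct_orbitClass (μ := μ) (p := p) (n := n) b b'
  let star : W ℤ M p n →+ W ℤ N p n →+ W ℤ P p n := ((orbitBasis p n b).constr ℤ fun s =>
    ((orbitBasis p n b').constr ℤ (f s)).toAddMonoidHom).toAddMonoidHom
  have hstar (s t) : star (orbitClass p n b s) (orbitClass p n b' t) = f s t := by
    have h1 : star (orbitClass p n b s) = ((orbitBasis p n b').constr ℤ (f s)).toAddMonoidHom := by
      rw [← orbitBasis_apply]
      exact (orbitBasis p n b).constr_basis ℤ _ s
    rw [h1, ← orbitBasis_apply]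
    exact (orbitBasis p n b').constr_basis ℤ _ t
  refine ⟨star, fun v w => ?_⟩
  induction mem_closure_range_orbitClass p n b v using AddSubgroup.closure_induction with
  | mem v hv =>
    obtain ⟨s, rfl⟩ := hv
    induction mem_closure_range_orbitClass p n b' w using AddSubgroup.closure_induction with
    | mem w hw =>
      obtain ⟨t, rfl⟩ := hw
      rw [hstar]
      exact hf s t
    | zero => rw [map_zero]; exact isGhostProduct_zero_right μ p _
    | add x y _ _ hx hy => rw [map_add]; exact hx.add_right hy
    | neg x _ hx => rw [map_neg]; exact hx.neg_right
  | zero => rw [map_zero]; exact isGhostProduct_zero_left μ p _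
  | add x y _ _ hx hy => rw [map_add]; exact hx.add_left hy
  | neg x _ hx => rw [map_neg]; exact hx.neg_left

theorem ghost_eq_of_isGhostProduct (b : Module.Basis ν ℤ P)
    {a : ∀ i : Fin (n + 1), ⨂[ℤ]^(p ^ (i : ℕ)) M} {a' : ∀ i : Fin (n + 1), ⨂[ℤ]^(p ^ (i : ℕ)) N}
    {c : ∀ i : Fin (n + 1), ⨂[ℤ]^(p ^ (i : ℕ)) P}
    (h : IsGhostProduct μ p (wittCoord ℤ p n a) (wittCoord ℤ p n a') (wittCoord ℤ p n c))
    (j : ℕ) (hj : j ≤ n) :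
    ghost p n j c = tensorMap₂ μ (p ^ j) (ghost p n j a) (ghost p n j a') := by
  have hne : (p : ℤ) ^ j ≠ 0 := pow_ne_zero j (Nat.cast_ne_zero.2 hp.out.ne_zero)
  exact (smul_tensor_cancel b hne
    (smul_tensor_cancel b hne (isGhostProduct_wittCoord.1 h j hj))).symm

variable (μ p n) in
/-- The words in bases of `M` and `N` determine a product on the truncated Witt vectors, which is
characterized by its ghost components. -/
theorem exists_unique_pairing (b : Module.Basis ι ℤ M) (b' : Module.Basis κ ℤ N)
    (b'' : Module.Basis ν ℤ P) :
    ∃ star : W ℤ M p n →+ W ℤ N p n →+ W ℤ P p n,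
      (∀ a a' c, star (wittCoord ℤ p n a) (wittCoord ℤ p n a') = wittCoord ℤ p n c →
        ∀ j ≤ n, ghost p n j c = tensorMap₂ μ (p ^ j) (ghost p n j a) (ghost p n j a')) ∧
      (∀ star' : W ℤ M p n →+ W ℤ N p n →+ W ℤ P p n,
        (∀ a a' c, star' (wittCoord ℤ p n a) (wittCoord ℤ p n a') = wittCoord ℤ p n c →
          ∀ j ≤ n, ghost p n j c = tensorMap₂ μ (p ^ j) (ghost p n j a) (ghost p n j a')) →
        star' = star) ∧
      (∀ (i j : ℕ) (hij : i ≤ j) (hj : j ≤ n) (f : Fin (p ^ i) → M) (g : Fin (p ^ j) → N),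
        star (ver ℤ p (hij.trans hj) (teich ℤ p (n - i) (PiTensorProduct.tprod ℤ f)))
          (ver ℤ p hj (teich ℤ p (n - j) (PiTensorProduct.tprod ℤ g))) =
          ∑ s ∈ Finset.range (p ^ i), ver ℤ p hj (teich ℤ p (n - j)
            (tensorMap₂ μ (p ^ j) (tensPow p hij ((rot (p ^ i) ^ s) (PiTensorProduct.tprod ℤ f)))
              (PiTensorProduct.tprod ℤ g)))) ∧
      (∀ (i j : ℕ) (hji : j ≤ i) (hi : i ≤ n) (f : Fin (p ^ i) → M) (g : Fin (p ^ j) → N),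
        star (ver ℤ p hi (teich ℤ p (n - i) (PiTensorProduct.tprod ℤ f)))
          (ver ℤ p (hji.trans hi) (teich ℤ p (n - j) (PiTensorProduct.tprod ℤ g))) =
          ∑ s ∈ Finset.range (p ^ j), ver ℤ p hi (teich ℤ p (n - i)
            (tensorMap₂ μ (p ^ i) (PiTensorProduct.tprod ℤ f)
              (tensPow p hji ((rot (p ^ j) ^ s) (PiTensorProduct.tprod ℤ g)))))) := by
  obtain ⟨star, hstar⟩ := exists_pairing μ p n b b'
  refine ⟨star, fun a a' c hc => ghost_eq_of_isGhostProduct b'' (hc ▸ hstar _ _),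
    fun star' h' => ?_, ?_, ?_⟩
  · refine AddMonoidHom.ext fun v => AddMonoidHom.ext fun w => ?_
    exact (isGhostProduct_of_ghost h' v w).unique b'' (hstar v w)
  · intro i j hij hj f g
    obtain ⟨F, hF, hfF⟩ := exists_eq_seqTensor (R := ℤ) (pow_pos hp.out.pos i) f
    obtain ⟨G, hG, hgG⟩ := exists_eq_seqTensor (R := ℤ) (pow_pos hp.out.pos j) g
    refine (hstar _ _).unique b'' ?_
    rw [hfF, hgG]
    exact isGhostProduct_seqTensor_of_le hij hj hF hG
  · intro i j hji hi f g
    obtain ⟨F, hF, hfF⟩ := exists_eq_seqTensor (R := ℤ) (pow_pos hp.out.pos i) f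
    obtain ⟨G, hG, hgG⟩ := exists_eq_seqTensor (R := ℤ) (pow_pos hp.out.pos j) g
    refine (hstar _ _).unique b'' ?_
    rw [hfF, hgG]
    exact isGhostProduct_seqTensor_of_ge hji hi hF hG

end Pairing

end WittCoeff

end

open WittCoeff
theorem mainTheorem9 (p : ℕ) [Fact p.Prime] (n : ℕ) (X Y : Type*) :
    -- the elements `V^i τ^{n-i}(x)`, one for each cyclic orbit, form a basis
    (∃ b : Module.Basis (Σ i : Fin (n + 1), Quotient (cyclicSetoid X (p ^ (i : ℕ)))) ℤ
        (W ℤ (X →₀ ℤ) p n),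
      ∀ (i : Fin (n + 1)) (x : Fin (p ^ (i : ℕ)) → X),
        b ⟨i, Quotient.mk _ x⟩ = gen p (Nat.lt_succ_iff.1 i.2) x) ∧
    -- there is a unique biadditive product with monoidal ghost components, and it is given on the
    -- basis elements by the two formulas
    ∃ star : Pairing ℤ (X →₀ ℤ) (Y →₀ ℤ) p n,
      IsMonoidalProduct p n star ∧
      (∀ star', IsMonoidalProduct p n star' → star' = star) ∧
      (∀ (i j : ℕ) (hij : i ≤ j) (hj : j ≤ n) (x : Fin (p ^ i) → X) (y : Fin (p ^ j) → Y),
        star (gen p (hij.trans hj) x) (gen p hj y) =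
          ∑ s ∈ Finset.range (p ^ i), ver ℤ p hj (teich ℤ p (n - j)
            (shuffle (p ^ j) (tensPow p hij ((rot (p ^ i) ^ s) (word x))) (word y)))) ∧
      (∀ (i j : ℕ) (hji : j ≤ i) (hi : i ≤ n) (x : Fin (p ^ i) → X) (y : Fin (p ^ j) → Y),
        star (gen p hi x) (gen p (hji.trans hi) y) =
          ∑ s ∈ Finset.range (p ^ j), ver ℤ p hi (teich ℤ p (n - i)
            (shuffle (p ^ i) (word x) (tensPow p hji ((rot (p ^ j) ^ s) (word y)))))) := by
  let bX : Module.Basis X ℤ (X →₀ ℤ) := Finsupp.basisSingleOne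
  let bY : Module.Basis Y ℤ (Y →₀ ℤ) := Finsupp.basisSingleOne
  refine ⟨⟨orbitBasis p n bX, fun i x => ?_⟩, ?_⟩
  · rw [orbitBasis_apply, gen, ver_teich]
    change wordClass p n bX i x = _
    rw [wordClass]
    congr 3
  · exact exists_unique_pairing (P := (X →₀ ℤ) ⊗[ℤ] (Y →₀ ℤ)) (hP := TensorProduct.instModule)
      (TensorProduct.mk ℤ (X →₀ ℤ) (Y →₀ ℤ)) p n bX bY (bX.tensorProduct bY) |>.imp
        fun star h => ⟨h.1, h.2.1, fun i j hij hj x y => h.2.2.1 i j hij hj _ _,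
          fun i j hji hi x y => h.2.2.2 i j hji hi _ _⟩
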